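/- Let $q$ be a prime power, $n=q^2-1$, and let $P_1,\dots,P_n$ be the zeros of $X^n-1$ in $\mathbb F_{q^2}$. For $x\in\mathcal H=\{0,\dots,n-1\}=\mathbb Z/n\mathbb Z$ let $I_x=\{xq^s \bmod n : s\ge 0\}$ be its cyclotomic coset with respect to $q$, let $0=m_0<m_1<\dots<m_z$ be the least elements of the distinct cyclotomic cosets, and put $i_{m_j}=\#I_{m_j}$. Let $0\le t<z$ and $\Delta=\Delta(t)=\bigcup_{j=0}^t I_{m_j}$. Let $D_\Delta\subseteq\mathbb F_{q^2}^n$ be the $\mathbb F_{q^2}$-span of the vectors $(P_1^i,\dots,P_n^i)$, $i\in\Delta$, let $E_\Delta=D_\Delta\cap\mathbb F_q^n$ be the BCH code over $\mathbb F_q$, and let $C_\Delta$ be its dual code for the Euclidean inner product. Put $c=\dim E_\Delta-\dim(E_\Delta\cap C_\Delta)$, and let $m_t=b_0+b_1q$ with $0\le b_0,b_1<q$ be the $q$-adic expression of $m_t$. **Theorem.** The entanglement-assisted quantum error-correcting code given by $E_\Delta$ (the stabilizer code obtained by extending the operators $X(a)Z(b)$, $a,b\in E_\Delta$, on the $n$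 transmitted qudits to commuting operators on $n+c$ qudits, the last $c$ of which belong to $c$ maximally entangled pairs shared with the receiver) exists and has parameters $$\Big[\Big[q^2-1,\ q^2-1-2\sum_{j=0}^t i_{m_j}+c,\ \ge m_{t+1}+1;\ c\Big]\Big]_q ,$$ where $$\begin{aligned} c={}&1+4\Big(\tfrac{b_1(b_1+1)}2-\max\{0,b_1-\lceil \tfrac q2\rceil\}\,\big(b_1-\lfloor \tfrac q2\rfloor\big)+\max\big\{0,\,b_0-\max\{q-1-b_1,\,b_1\}+1\big\}\Big)\\ &-3\delta-2\max\Big\{0,\Big\lfloor\tfrac{m_t}{q+1}\Big\rfloor-\Big\lfloor\tfrac{q-1}2\Big\rfloor\Big\}-2\min\Big\{\Big\lfloor\tfrac{m_t}{q-1}\Big\rfloor,\Big\lfloor\tfrac q2\Big\rfloor\Big\}, \end{aligned}$$ with $\delta=1$ if $q$ is odd and $m_t\ge (q^2-1)/2$, and $\delta=0$ otherwise. (As usual, a code of dimension one, i.e. with second parameter $0$, is said to have minimum distance at least $d$ if it is pure to $d$.) -/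

import Mathlib

open scoped Matrix Kronecker

noncomputable section

/-! ### Cyclotomic cosets modulo `n` with respect to `q` -/

open scoped Classical in
/-- The cyclotomic coset `I_x = {x q ^ s : s ≥ 0}` in `ℤ/nℤ = {0, …, n - 1}`. -/
def cyclotomicCoset (n q x : ℕ) : Finset ℕ :=
  (Finset.range n).filter fun y => ∃ s : ℕ, y ≡ x * q ^ s [MOD n]

open scoped Classical in
/-- The set of the least elements of the cyclotomic cosets. -/
def minimalReps (n q : ℕ) : Finset ℕ :=
  (Finset.range n).filter fun x => ∀ y ∈ cyclotomicCoset n q x, x ≤ y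

/-- The `j`-th minimal representative `m_j`, in increasing order, starting with `m_0 = 0`
(meaningful for `j < (minimalReps n q).card`). -/
def minimalRep (n q j : ℕ) : ℕ :=
  Nat.nth (fun x => x ∈ minimalReps n q) j

/-- `Δ(t) = I_{m_0} ∪ … ∪ I_{m_t}`. -/
def consecutiveCosets (n q t : ℕ) : Finset ℕ :=
  (Finset.range (t + 1)).biUnion fun j => cyclotomicCoset n q (minimalRep n q j)

/-! ### Codes -/

/-- The Reed-Solomon (evaluation) code `D_Δ` spanned by the vectors `ev (X ^ i)`, `i ∈ Δ`, where
`ev` evaluates at the points `P j`. -/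
def rsCode {K : Type*} [Field K] {n : ℕ} (P : Fin n → K) (Δ : Finset ℕ) :
    Submodule K (Fin n → K) :=
  Submodule.span K ((fun i : ℕ => fun j : Fin n => P j ^ i) '' (Δ : Set ℕ))

/-- The BCH code `E_Δ`: the subfield subcode `D_Δ ∩ F ^ n` of the code `D_Δ` over `K ⊇ F`. -/
def bchCode (F : Type*) {K : Type*} [Field F] [Field K] [Algebra F K] {n : ℕ}
    (P : Fin n → K) (Δ : Finset ℕ) : Submodule F (Fin n → F) :=
  ((rsCode P Δ).restrictScalars F).comap ((Algebra.linearMap F K).compLeft (Fin n))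

/-- The Euclidean dual code `{y : x ⬝ y = 0 for all x ∈ E}`. -/
def euclideanDual {F : Type*} [Field F] {n : ℕ} (E : Submodule F (Fin n → F)) :
    Submodule F (Fin n → F) where
  carrier := {y | ∀ x ∈ E, x ⬝ᵥ y = 0}
  add_mem' := by
    intro y z hy hz x hx
    rw [dotProduct_add, hy x hx, hz x hx, add_zero]
  zero_mem' := by
    intro x _
    exact dotProduct_zero x
  smul_mem' := by
    intro r y hy x hx
    rw [dotProduct_smul, hy x hx, smul_zero]

/-! ### Entanglement-assisted quantum error-correcting codes

One qudit has the state space `ℂ ^ F` with orthonormal basis `|x⟩`, `x ∈ F`, so `n` qudits have the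
state space `ℂ ^ (Fin n → F)`. -/

/-- An entanglement-assisted code encoding `k` qudits into `n` qudits with the help of `c` maximally
entangled pairs: the sender applies the unitary `U` to the `k` information qudits, to his halves of
the `c` entangled pairs, and to `a = n - k - c` ancilla qudits in the state `|0⟩`. -/
structure EAQECC (F : Type*) [Fintype F] [DecidableEq F] [Zero F] (n k c : ℕ) where
  /-- the number of ancilla qudits -/
  a : ℕ
  length_eq : k + c + a = n
  /-- the encoding unitary of the sender -/
  U : Matrix (Fin n → F) ((Fin k → F) × (Fin c → F) × (Fin a → F)) ℂ
  star_mul : Uᴴ * U = 1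
  mul_star : U * Uᴴ = 1

namespace EAQECC

variable {F : Type*} [Fintype F] [DecidableEq F] [Zero F] {n k c : ℕ}

/-- The encoding isometry from `k` qudits to the `n` qudits sent through the channel together with
the `c` qudits that the receiver holds from the start:
`|u⟩ ↦ (U ⊗ 1) (|u⟩ ⊗ |Φ⟩ ⊗ |0⟩)`, where `|Φ⟩ = |F| ^ (-c/2) ∑ v, |v⟩ ⊗ |v⟩`. -/
def encode (Q : EAQECC F n k c) : Matrix ((Fin n → F) × (Fin c → F)) (Fin k → F) ℂ :=
  fun xv u => ((Real.sqrt ((Fintype.card F : ℝ) ^ c))⁻¹ : ℝ) * Q.U xv.1 (u, xv.2, 0)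

end EAQECC

open scoped Classical in
/-- The operator `M` on `n` qudits acts only on the qudits in `S`: it is `N ⊗ 1` for an operator `N`
on these qudits. -/
def ActsOnlyOn {F : Type*} {n : ℕ} (S : Finset (Fin n))
    (M : Matrix (Fin n → F) (Fin n → F) ℂ) : Prop :=
  ∃ N : Matrix (S → F) (S → F) ℂ, ∀ x y : Fin n → F,
    M x y = if ∀ i ∉ S, x i = y i then N (fun i => x i) (fun i => y i) else 0

/-- The minimum distance is at least `d`: every error on fewer than `d` of the `n` transmitted
qudits (the receiver's own qudits are free of errors) is detected, by the Knill-Laflamme condition;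
and, by the usual convention for one-dimensional codes (`k = 0`), where this condition is empty,
such a code has to be pure, that is, the scalar is the normalized trace of the error. -/
def EAQECC.MinDistGE {F : Type*} [Fintype F] [DecidableEq F] [Zero F] {n k c : ℕ}
    (Q : EAQECC F n k c) (d : ℕ) : Prop :=
  ∀ S : Finset (Fin n), S.card < d → ∀ M : Matrix (Fin n → F) (Fin n → F) ℂ, ActsOnlyOn S M →
    ∃ l : ℂ, Q.encodeᴴ * (M ⊗ₖ (1 : Matrix (Fin c → F) (Fin c → F) ℂ)) * Q.encode = l • 1 ∧
      (k = 0 → l = M.trace / (Fintype.card F : ℂ) ^ n)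

/-- The generalized Pauli operator `X(a) Z(b) : |x⟩ ↦ χ (b ⬝ x) |x + a⟩`. -/
def pauli {F : Type*} [Field F] [DecidableEq F] {n : ℕ} (χ : AddChar F ℂ) (a b : Fin n → F) :
    Matrix (Fin n → F) (Fin n → F) ℂ :=
  fun y x => if y = x + a then χ (b ⬝ᵥ x) else 0

/-- The code `Q` is the stabilizer code given by the linear code `E` (Euclidean construction): each
of the operators `X(a) Z(b)`, `a, b ∈ E`, on the `n` transmitted qudits extends by some `X(a') Z(b')`
on the `c` qudits of the receiver to an operator that acts on the code space as a scalar. -/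
def EAQECC.IsConstructedFrom {F : Type*} [Field F] [Fintype F] [DecidableEq F] {n k c : ℕ}
    (Q : EAQECC F n k c) (E : Submodule F (Fin n → F)) : Prop :=
  ∀ χ : AddChar F ℂ, ∀ a ∈ E, ∀ b ∈ E, ∃ a' b' : Fin c → F, ∃ l : ℂ,
    (pauli χ a b ⊗ₖ pauli χ a' b') * Q.encode = l • Q.encode

end

/-! ### Linear algebra of the Euclidean dual -/

section Dual

variable {F : Type*} [Field F] {n : ℕ}

/-! The quantum half holds for any linear code `E`. With `R = E ∩ E^⊥`, write `E = R ⊕ W` and `E^⊥ =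
R ⊕ H`, where `dim W = c` and `dim H = k`. The encoded state of `h ∈ H` is the superposition over `w
∈ W` of the uniform state on the coset `h + w + R`, tensored with the receiver's label of `w`. A
shift by an element of `E` relabels `w`, and a phase from `E` depends only on `w`, so both can be
undone on the receiver's side. An error on a set `S` that supports no nonzero word of `E^⊥` cannot
connect two different strings in the supports for the same label. Its diagonal contributes the mean
over a coset of `E`, which is the normalized trace because `E` projects onto `F ^ S`. This is
`exists_eaqecc`, and it gives purity as well.

For the BCH codes the points are all the units of `K`, so finite Fourier inversion describes `D_Δ`
by its spectrum. With the trace form this gives `E_Δ^⊥ = E_{Δ'}`, where `Δ'` is the complement of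
`-Δ`. Hence `dim E_Δ = #Δ`, `E_Δ ∩ E_Δ^⊥ = E_{Δ \ -Δ}` and `c = #(Δ ∩ -Δ)`. All exponents below
`m_{t+1}` lie in `Δ`, so the BCH bound on the dual gives the distance.

The count uses base-`q` digits: modulo `q ^ 2 - 1`, multiplication by `q` swaps the two digits and
negation of a nonzero exponent complements both. Membership in `Δ ∩ -Δ` becomes a condition on pairs
of digits, counted in `card_filter_min_le` and matched with the closed formula in
`count_eq_formula`. -/

theorem mem_euclideanDual {E : Submodule F (Fin n → F)} {y : Fin n → F} :
    y ∈ euclideanDual E ↔ ∀ x ∈ E, x ⬝ᵥ y = 0 :=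
  Iff.rfl

theorem finrank_add_finrank_euclideanDual (E : Submodule F (Fin n → F)) :
    Module.finrank F E + Module.finrank F (euclideanDual E) = n := by
  have h : euclideanDual E = (E.dualAnnihilator).comap
      (dotProductEquiv F (Fin n)).toLinearMap := by
    ext y
    simp [mem_euclideanDual, Submodule.mem_dualAnnihilator, dotProduct_comm y]
  have h2 : Module.finrank F (euclideanDual E) = Module.finrank F E.dualAnnihilator := by
    rw [h]
    exact ((dotProductEquiv F (Fin n)).submoduleMap
      ((E.dualAnnihilator).comap (dotProductEquiv F (Fin n)).toLinearMap)).finrank_eq.trans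
      (by rw [Submodule.map_comap_eq_of_surjective (dotProductEquiv F (Fin n)).surjective])
  rw [h2, Subspace.finrank_add_finrank_dualAnnihilator_eq]
  simp

/-- If the dual code has no nonzero word supported on `S`, then `E` projects onto all of `F ^ S`. -/
theorem restrict_surjective_of_euclideanDual {E : Submodule F (Fin n → F)} {S : Finset (Fin n)}
    (hS : ∀ x ∈ euclideanDual E, (∀ i ∉ S, x i = 0) → x = 0) :
    Function.Surjective fun (e : E) (i : S) => (e : Fin n → F) i := by
  classical
  let f : (Fin n → F) →ₗ[F] (S → F) := LinearMap.funLeft F F (fun i : S => (i : Fin n))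
  have htop : E.map f = ⊤ := by
    by_contra hne
    -- A functional on `F ^ S` that kills the projection of `E`, extended by zero outside `S`, is a
    -- dual word supported on `S`.
    obtain ⟨g, hg, hle⟩ := Submodule.exists_le_ker_of_lt_top _ (lt_top_iff_ne_top.mpr hne)
    let x : Fin n → F := fun i => if h : i ∈ S then g (Pi.single ⟨i, h⟩ 1) else 0
    have hgx : ∀ y : Fin n → F, g (f y) = y ⬝ᵥ x := by
      intro y
      rw [g.pi_apply_eq_sum_univ (f y), dotProduct,
        ← Finset.sum_subset (Finset.subset_univ S) (by intro i _ hi; simp [x, hi]),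
        ← Finset.sum_coe_sort S]
      refine Finset.sum_congr rfl fun i _ => ?_
      have : (fun j : S => if i = j then (1 : F) else 0) = Pi.single i 1 := by
        ext j
        simp [Pi.single_apply, eq_comm]
      simp [x, f, LinearMap.funLeft_apply, this]
    have hx : x = 0 := by
      refine hS x (fun e he => ?_) fun i hi => by simp [x, hi]
      rw [← hgx]
      exact hle (Submodule.mem_map_of_mem he)
    refine hg (LinearMap.ext fun z => ?_)
    obtain ⟨y, rfl⟩ : ∃ y, f y = z :=
      LinearMap.funLeft_surjective_of_injective F F _ Subtype.val_injective z
    rw [hgx, hx, dotProduct_zero, LinearMap.zero_apply]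
  intro z
  obtain ⟨e, he, hez⟩ := (htop ▸ Submodule.mem_top : z ∈ E.map f)
  exact ⟨⟨e, he⟩, hez⟩

/-- A complement of `R` inside `E`, parametrized by coordinates. -/
theorem exists_param_compl {V : Type*} [AddCommGroup V] [Module F V] [FiniteDimensional F V]
    {R E : Submodule F V} (hRE : R ≤ E) {c : ℕ}
    (hc : c + Module.finrank F R = Module.finrank F E) :
    ∃ w : (Fin c → F) →ₗ[F] V, (∀ v, w v ∈ E) ∧ (∀ v, w v ∈ R → v = 0) ∧
      ∀ e ∈ E, ∃ v, e - w v ∈ R := by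
  obtain ⟨W0, hW0⟩ := R.exists_isCompl
  have hsup : R ⊔ W0 ⊓ E = E := by
    rw [← sup_inf_assoc_of_le _ hRE, hW0.sup_eq_top, top_inf_eq]
  have hinf : R ⊓ (W0 ⊓ E) = ⊥ := by
    rw [← inf_assoc, hW0.inf_eq_bot, bot_inf_eq]
  have hdim := Submodule.finrank_sup_add_finrank_inf_eq R (W0 ⊓ E)
  rw [hsup, hinf, finrank_bot] at hdim
  let φ : (Fin c → F) ≃ₗ[F] ↥(W0 ⊓ E) := LinearEquiv.ofFinrankEq _ _ (by simp; omega)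
  refine ⟨(W0 ⊓ E).subtype ∘ₗ φ.toLinearMap, fun v => (φ v).2.2, fun v hv => ?_, fun e he => ?_⟩
  · have : ((φ v : ↥(W0 ⊓ E)) : V) ∈ R ⊓ (W0 ⊓ E) := ⟨hv, (φ v).2⟩
    rw [hinf, Submodule.mem_bot] at this
    exact φ.map_eq_zero_iff.mp (Subtype.ext this)
  · rw [← hsup] at he
    obtain ⟨r, hr, w, hw, rfl⟩ := Submodule.mem_sup.mp he
    exact ⟨φ.symm ⟨w, hw⟩, by simpa using hr⟩

end Dual

/-- The mean value of `φ ∘ f` for a surjective homomorphism `f` is the mean value of `φ`. -/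
theorem sum_comp_of_surjective {G H : Type*} [AddGroup G] [AddGroup H] [Fintype G] [Fintype H]
    (f : G →+ H) (hf : Function.Surjective f) (φ : H → ℂ) :
    (∑ g, φ (f g)) / (Fintype.card G : ℂ) = (∑ h, φ h) / (Fintype.card H : ℂ) := by
  classical
  have hfib : ∀ h : H, (Finset.univ.filter fun g => f g = h).card
      = (Finset.univ.filter fun g => f g = 0).card := fun h =>
    AddMonoidHom.card_fiber_eq_of_mem_range f (hf h) (hf 0)
  set N := (Finset.univ.filter fun g => f g = 0).card with hN
  have hsum : ∀ ψ : H → ℂ, ∑ g, ψ (f g) = N * ∑ h, ψ h := by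
    intro ψ
    rw [← Finset.sum_fiberwise Finset.univ f, Finset.mul_sum]
    refine Finset.sum_congr rfl fun h _ => ?_
    rw [Finset.sum_congr rfl (g := fun _ => ψ h) (by
      intro g hg; rw [(Finset.mem_filter.mp hg).2]), Finset.sum_const, hfib h, nsmul_eq_mul]
  have hcard : (Fintype.card G : ℂ) = N * Fintype.card H := by
    simpa using hsum fun _ => 1
  have hNpos : (N : ℂ) ≠ 0 := by
    intro h0
    rw [h0, zero_mul] at hcard
    exact (Nat.cast_ne_zero.mpr (Fintype.card_ne_zero (α := G))) hcard
  rw [hsum, hcard, mul_div_mul_left _ _ hNpos]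

/-! ### The stabilizer code of a linear code -/

section Quantum

variable {F : Type*} [Field F] [Fintype F] [DecidableEq F] {n k c : ℕ}

open scoped Classical in
/-- An encoding unitary that maps `|p⟩ ⊗ |0⟩` to the uniform superposition of the coset
`T p + R`. -/
theorem exists_coset_unitary {a : ℕ} (hn : k + c + a = n) (R : Submodule F (Fin n → F))
    (T : (Fin k → F) × (Fin c → F) →ₗ[F] (Fin n → F)) (hT : ∀ p, T p ∈ R → p = 0) :
    ∃ Q : EAQECC F n k c, ∀ x u v, Q.U x (u, v, 0) =
      if x - T (u, v) ∈ R then (((Real.sqrt (Nat.card R))⁻¹ : ℝ) : ℂ) else 0 := by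
  set κ : ℂ := (((Real.sqrt (Nat.card R))⁻¹ : ℝ) : ℂ) with hκ
  let s : Set ((Fin k → F) × (Fin c → F) × (Fin a → F)) := {i | i.2.2 = 0}
  let vec : (Fin k → F) × (Fin c → F) × (Fin a → F) → EuclideanSpace ℂ (Fin n → F) := fun i => WithLp.toLp 2 fun x => if x - T (i.1, i.2.1) ∈ R then κ else 0
  have hcardι : Module.finrank ℂ (EuclideanSpace ℂ (Fin n → F)) = Fintype.card ((Fin k → F) × (Fin c → F) × (Fin a → F)) := by
    simp only [finrank_euclideanSpace, Fintype.card_pi, Fintype.card_prod,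
      Finset.prod_const, Finset.card_univ, Fintype.card_fin, ← hn]
    ring
  have hκκ : (Nat.card R : ℂ) * (starRingEnd ℂ κ * κ) = 1 := by
    rw [hκ, Complex.conj_ofReal, ← Complex.ofReal_mul, ← mul_inv,
      Real.mul_self_sqrt (Nat.cast_nonneg _), Complex.ofReal_inv, Complex.ofReal_natCast]
    exact mul_inv_cancel₀ (Nat.cast_ne_zero.mpr Nat.card_pos.ne')
  -- Distinct parameters give distinct cosets of `R`, so the states have disjoint supports. The
  -- columns with nonzero ancilla may be any completion to an orthonormal basis.
  have hvec : Orthonormal ℂ (s.domRestrict vec) := by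
    rw [orthonormal_iff_ite]
    rintro ⟨⟨u, v, w⟩, hw⟩ ⟨⟨u', v', w'⟩, hw'⟩
    obtain rfl : w = 0 := hw
    obtain rfl : w' = 0 := hw'
    change inner ℂ (vec (u, v, 0)) (vec (u', v', 0)) = _
    simp only [vec, PiLp.inner_apply, RCLike.inner_apply]
    split_ifs with h
    · obtain ⟨rfl, rfl⟩ : u = u' ∧ v = v' := by simpa [Subtype.ext_iff] using h
      rw [← hκκ, Finset.sum_congr rfl (g := fun x => if x - T (u, v) ∈ R then
        starRingEnd ℂ κ * κ else 0) (by intro x _; split_ifs <;> simp [mul_comm]),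
        ← Finset.sum_filter, Finset.sum_const, nsmul_eq_mul]
      congr 2
      rw [Nat.card_eq_fintype_card, Fintype.card_subtype]
      refine Finset.card_bij' (fun x _ => x - T (u, v)) (fun y _ => y + T (u, v)) ?_ ?_ ?_ ?_ <;>
        simp
    · refine Finset.sum_eq_zero fun x _ => ?_
      split_ifs with h1 h2
      · exfalso
        have : T ((u, v) - (u', v')) ∈ R := by
          rw [map_sub]
          convert R.sub_mem h1 h2 using 1
          abel
        have := hT _ this
        simp only [sub_eq_zero] at this
        exact h (by simpa [Subtype.ext_iff] using this)
      all_goals simp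
  obtain ⟨b, hb⟩ := hvec.exists_orthonormalBasis_extension_of_card_eq hcardι
  let U : Matrix (Fin n → F) ((Fin k → F) × (Fin c → F) × (Fin a → F)) ℂ := fun x i => b i x
  have hU : Uᴴ * U = 1 := by
    ext i j
    have := orthonormal_iff_ite.mp b.orthonormal i j
    rw [Matrix.mul_apply, Matrix.one_apply, ← this, PiLp.inner_apply]
    exact Finset.sum_congr rfl fun x _ => mul_comm _ _
  have hU' : U * Uᴴ = 1 := by
    refine (Matrix.mul_eq_one_comm_of_card_eq _ _ _ ?_).mp hU
    rw [← hcardι]; simp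
  refine ⟨⟨a, hn, U, hU, hU'⟩, fun x u v => ?_⟩
  have := hb (u, v, 0) (show ((u, v, 0) : (Fin k → F) × (Fin c → F) × (Fin a → F)).2.2 = 0 from rfl)
  simp only [U, this, vec]

theorem pauli_kronecker_mul_apply (χ : AddChar F ℂ) (a b : Fin n → F) (a' b' : Fin c → F)
    (A : Matrix ((Fin n → F) × (Fin c → F)) (Fin k → F) ℂ) (y : Fin n → F) (w : Fin c → F)
    (u : Fin k → F) :
    ((pauli χ a b ⊗ₖ pauli χ a' b') * A) (y, w) u =
      χ (b ⬝ᵥ (y - a)) * χ (b' ⬝ᵥ (w - a')) * A (y - a, w - a') u := by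
  rw [Matrix.mul_apply, Finset.sum_eq_single (y - a, w - a')]
  · simp [pauli]
  · rintro ⟨x, v⟩ _ hne
    have : ¬ (y = x + a ∧ w = v + a') := by
      rintro ⟨rfl, rfl⟩
      simp at hne
    rw [Matrix.kroneckerMap_apply]
    simp only [pauli]
    rcases not_and_or.mp this with h | h <;> simp [h]
  · simp

end Quantum

/-! ### Detection of local errors -/

section Quantum

theorem conjTranspose_mul_kronecker_one_mul_apply {F : Type*} [Fintype F] [DecidableEq F]
    {n k c : ℕ}
    (A : Matrix ((Fin n → F) × (Fin c → F)) (Fin k → F) ℂ)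
    (M : Matrix (Fin n → F) (Fin n → F) ℂ) (u u' : Fin k → F) :
    (Aᴴ * (M ⊗ₖ (1 : Matrix (Fin c → F) (Fin c → F) ℂ)) * A) u u' =
      ∑ v, ∑ x, ∑ y, star (A (x, v) u) * M x y * A (y, v) u' := by
  rw [Matrix.mul_assoc, Matrix.mul_apply, Fintype.sum_prod_type, Finset.sum_comm]
  refine Finset.sum_congr rfl fun v _ => Finset.sum_congr rfl fun x _ => ?_
  rw [Matrix.mul_apply, Fintype.sum_prod_type, Finset.mul_sum]
  refine Finset.sum_congr rfl fun y _ => ?_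
  rw [Finset.sum_eq_single v]
  · simp [mul_assoc]
  · intro w _ hw
    simp [hw.symm]
  · simp

/-- The mean value of the diagonal entries of a local operator over a coset of `E` is its
normalized trace. -/
theorem sum_diag_coset {F : Type*} [Field F] [Fintype F] {n : ℕ}
    {E : Submodule F (Fin n → F)} [Fintype E] {S : Finset (Fin n)}
    (hS : ∀ x ∈ euclideanDual E, (∀ i ∉ S, x i = 0) → x = 0)
    {M : Matrix (Fin n → F) (Fin n → F) ℂ} (hM : ActsOnlyOn S M) (z : Fin n → F) :
    (∑ e : E, M (e + z) (e + z)) / (Fintype.card E : ℂ) = M.trace / (Fintype.card F : ℂ) ^ n := by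
  obtain ⟨N, hN⟩ := hM
  have hdiag : ∀ x, M x x = N (fun i => x i) (fun i => x i) := fun x => by simp [hN]
  let f : (Fin n → F) →+ (S → F) :=
    (LinearMap.funLeft F F (fun i : S => (i : Fin n))).toAddMonoidHom
  have hfE : Function.Surjective (f.comp E.subtype.toAddMonoidHom) :=
    restrict_surjective_of_euclideanDual hS
  have hf : Function.Surjective f := fun y => by
    obtain ⟨e, he⟩ := hfE y
    exact ⟨e, he⟩
  have h1 := sum_comp_of_surjective _ hfE fun y => N (y + f z) (y + f z)
  have h2 := sum_comp_of_surjective _ hf fun y => N y y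
  have hshift : ∑ y : S → F, N (y + f z) (y + f z) = ∑ y, N y y :=
    Equiv.sum_comp (Equiv.addRight (f z)) fun y => N y y
  rw [hshift, ← h2] at h1
  have hcard : (Fintype.card (Fin n → F) : ℂ) = (Fintype.card F : ℂ) ^ n := by simp
  rw [hcard] at h1
  rw [Matrix.trace]
  simp only [Matrix.diag_apply, hdiag]
  exact h1

variable {F : Type*} [Field F] [Fintype F] [DecidableEq F] {n k c : ℕ}

/-- The stabilizer code of a linear code `E`, with the help of as many entangled pairs as the rank
of the form on `E`, detects all errors that are shorter than the words of the dual code. -/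
theorem exists_eaqecc {d : ℕ} (E : Submodule F (Fin n → F))
    (hc : c + Module.finrank F ↥(E ⊓ euclideanDual E) = Module.finrank F E)
    (hk : k + 2 * Module.finrank F E = n + c)
    (hd : ∀ x ∈ euclideanDual E, ∀ S : Finset (Fin n), S.card < d → (∀ i ∉ S, x i = 0) → x = 0) :
    ∃ Q : EAQECC F n k c, Q.IsConstructedFrom E ∧ Q.MinDistGE d := by
  classical
  set R := E ⊓ euclideanDual E with hR
  have hdual := finrank_add_finrank_euclideanDual E
  obtain ⟨w, hwE, hwR, hwcov⟩ := exists_param_compl (R := R) (inf_le_left : R ≤ E) hc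
  obtain ⟨h, hhE, hhR, -⟩ := exists_param_compl (c := k) (R := R) (inf_le_right : R ≤ euclideanDual E)
    (by omega)
  have hT : ∀ p : (Fin k → F) × (Fin c → F), (h.coprod w) p ∈ R → p = 0 := by
    rintro ⟨u, v⟩ hp
    rw [LinearMap.coprod_apply] at hp
    have hu : h u ∈ E := by simpa using E.sub_mem hp.1 (hwE v)
    obtain rfl := hhR u ⟨hu, hhE u⟩
    rw [map_zero, zero_add] at hp
    rw [hwR v hp]
    rfl
  -- The number of ancillas is forced: `n - k - c = 2 (dim E - c) = 2 dim R`.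
  obtain ⟨Q, hQ⟩ := exists_coset_unitary (a := 2 * Module.finrank F R) (by omega) R _ hT
  -- The two normalizations combine, since `#E = #F ^ c * #R`.
  obtain ⟨μ, hμ, henc⟩ : ∃ μ : ℂ, star μ * μ = (Fintype.card E : ℂ)⁻¹ ∧
      ∀ x v u, Q.encode (x, v) u = if x - (h u + w v) ∈ R then μ else 0 := by
    refine ⟨((Real.sqrt ((Fintype.card F : ℝ) ^ c))⁻¹ : ℝ) * ((Real.sqrt (Nat.card R))⁻¹ : ℝ),
      ?_, fun x v u => ?_⟩
    · rw [← Complex.ofReal_mul, Complex.star_def, Complex.conj_ofReal, ← Complex.ofReal_mul,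
        ← mul_inv, ← Real.sqrt_mul (by positivity), ← mul_inv,
        Real.mul_self_sqrt (by positivity), Nat.card_eq_fintype_card,
        Module.card_eq_pow_finrank (K := F) (V := R), Module.card_eq_pow_finrank (K := F) (V := E),
        ← hc, pow_add]
      push_cast
      rfl
    · rw [EAQECC.encode, hQ, LinearMap.coprod_apply, mul_ite, mul_zero]
  refine ⟨Q, fun χ a ha b hb => ?_, fun S hS M hM => ?_⟩
  · obtain ⟨a', ha'⟩ := hwcov a ha
    -- On the support at label `v`, an element `b` of `E` pairs to `b ⬝ w v`, because `b` is
    -- orthogonal to `R` and to the image of `h`. The phase on the receiver's qudits is chosen to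
    -- cancel this linear form in `v`.
    refine ⟨a', fun i => -(b ⬝ᵥ w (Pi.single i 1)), 1, ?_⟩
    have hb' : ∀ v, (fun i => -(b ⬝ᵥ w (Pi.single i 1))) ⬝ᵥ v = -(b ⬝ᵥ w v) := by
      intro v
      have hv : w v = ∑ i, v i • w (Pi.single i 1) := by
        conv_lhs => rw [← Finset.univ_sum_single v, map_sum]
        refine Finset.sum_congr rfl fun i _ => ?_
        rw [← map_smul]
        congr 1
        ext j
        simp [Pi.single_apply]
      rw [hv, dotProduct_sum, dotProduct, ← Finset.sum_neg_distrib]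
      refine Finset.sum_congr rfl fun i _ => ?_
      rw [dotProduct_smul, smul_eq_mul]
      ring
    ext ⟨y, v⟩ u
    rw [pauli_kronecker_mul_apply, one_smul, henc, henc]
    have hiff : y - a - (h u + w (v - a')) ∈ R ↔ y - (h u + w v) ∈ R := by
      rw [← R.add_mem_iff_left ha', map_sub]
      congr! 1
      abel
    by_cases hy : y - (h u + w v) ∈ R
    · rw [if_pos (hiff.mpr hy), if_pos hy]
      have h0 := (hiff.mpr hy).2 b hb
      rw [dotProduct_sub, dotProduct_add, hhE u b hb, zero_add, sub_eq_zero] at h0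
      rw [hb', h0, ← AddChar.map_add_eq_mul, add_neg_cancel, AddChar.map_zero_eq_one, one_mul]
    · rw [if_neg (hiff.not.mpr hy), if_neg hy, mul_zero]
  · have hS' : ∀ x ∈ euclideanDual E, (∀ i ∉ S, x i = 0) → x = 0 := fun x hx => hd x hx S hS
    refine ⟨M.trace / (Fintype.card F : ℂ) ^ n, ?_, fun _ => rfl⟩
    -- For fixed `u`, the cosets `h u + w v + R` partition `h u + E`.
    have hcov : ∀ x u, ∑ v, (if x - (h u + w v) ∈ R then (1 : ℂ) else 0)
        = if x - h u ∈ E then 1 else 0 := by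
      intro x u
      split_ifs with hx
      · obtain ⟨v, hv⟩ := hwcov _ hx
        rw [sub_sub] at hv
        rw [Finset.sum_eq_single v, if_pos hv]
        · intro v' _ hne
          refine if_neg fun hv' => hne ?_
          rw [← sub_eq_zero]
          refine hwR _ ?_
          rw [map_sub]
          convert R.sub_mem hv hv' using 1
          abel
        · simp
      · refine Finset.sum_eq_zero fun v _ => if_neg fun hv => hx ?_
        convert E.add_mem hv.1 (hwE v) using 1
        abel
    -- Both strings carry the same label `v`, so `w v` cancels and `x - y` lies in `E^⊥`. It is
    -- supported on `S`, hence zero.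
    have hzero : ∀ u u' v x y, M x y ≠ 0 → x - (h u + w v) ∈ R → y - (h u' + w v) ∈ R →
        x = y ∧ u = u' := by
      intro u u' v x y hxy hx hy
      have hx0 : x - y = 0 := by
        refine hS' _ ?_ fun i hi => ?_
        · convert (euclideanDual E).add_mem (Submodule.sub_mem _ hx.2 hy.2)
            (Submodule.sub_mem _ (hhE u) (hhE u')) using 1
          abel
        · obtain ⟨N, hN⟩ := hM
          have hval := hN x y
          split_ifs at hval with hoff
          · simp [hoff i hi]
          · exact absurd hval hxy
      rw [sub_eq_zero] at hx0
      refine ⟨hx0, ?_⟩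
      subst hx0
      rw [← sub_eq_zero]
      have hmem : h (u - u') ∈ R := by
        rw [map_sub]
        convert R.sub_mem hy hx using 1
        abel
      exact hhR _ hmem
    ext u u'
    rw [conjTranspose_mul_kronecker_one_mul_apply, Matrix.smul_apply, Matrix.one_apply,
      smul_eq_mul, mul_ite, mul_one, mul_zero]
    simp only [henc]
    split_ifs with huu
    · subst huu
      have hterm : ∀ v x, ∑ y, star (if x - (h u + w v) ∈ R then μ else 0) * M x y *
          (if y - (h u + w v) ∈ R then μ else 0) =
          (star μ * μ) * M x x * (if x - (h u + w v) ∈ R then 1 else 0) := by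
        intro v x
        rw [Finset.sum_eq_single x]
        · split_ifs
          · ring
          · simp
        · intro y _ hne
          by_cases hxy : M x y = 0
          · simp [hxy]
          · by_cases h1 : x - (h u + w v) ∈ R
            · rw [if_neg (c := y - (h u + w v) ∈ R), mul_zero]
              exact fun h2 => hne (hzero u u v x y hxy h1 h2).1.symm
            · simp [h1]
        · simp
      simp only [hterm]
      rw [Finset.sum_comm]
      simp only [← Finset.mul_sum, hcov]
      simp only [mul_assoc, ← Finset.mul_sum]
      rw [← mul_assoc, hμ, ← sum_diag_coset hS' hM (h u), div_eq_inv_mul]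
      congr 1
      simp only [mul_ite, mul_one, mul_zero]
      rw [← Finset.sum_filter]
      refine Finset.sum_bij' (fun x hx => ⟨x - h u, (Finset.mem_filter.mp hx).2⟩)
        (fun e _ => (e : Fin n → F) + h u) ?_ ?_ ?_ ?_ ?_ <;> simp
    · refine Finset.sum_eq_zero fun v _ => Finset.sum_eq_zero fun x _ =>
        Finset.sum_eq_zero fun y _ => ?_
      by_cases hxy : M x y = 0
      · simp [hxy]
      · by_cases h1 : x - (h u + w v) ∈ R
        · rw [if_neg (c := y - (h u' + w v) ∈ R), mul_zero]
          exact fun h2 => huu (hzero u u' v x y hxy h1 h2).2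
        · simp [h1]

end Quantum

/-! ### Dimensions, duals and distances of BCH codes of length `#K - 1` -/

section BCH

variable {F K : Type*} [Field F] [Field K] [Algebra F K] {n : ℕ}

theorem mem_bchCode {P : Fin n → K} {Δ : Finset ℕ} {x : Fin n → F} :
    x ∈ bchCode F P Δ ↔ (fun j => algebraMap F K (x j)) ∈ rsCode P Δ :=
  Iff.rfl

theorem pow_mem_rsCode (P : Fin n → K) {Δ : Finset ℕ} {i : ℕ} (hi : i ∈ Δ) :
    (fun j => P j ^ i) ∈ rsCode P Δ :=
  Submodule.subset_span ⟨i, hi, rfl⟩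

/-- Words over `F` that are independent over `F` stay independent over `K`, as the coordinates of a
relation with respect to a basis of `K` over `F` show. -/
theorem finrank_bchCode_le (P : Fin n → K) (Δ : Finset ℕ) :
    Module.finrank F (bchCode F P Δ) ≤ Δ.card := by
  classical
  let b := Module.finBasis F (bchCode F P Δ)
  let v : Fin (Module.finrank F (bchCode F P Δ)) → rsCode P Δ := fun l =>
    ⟨fun j => algebraMap F K ((b l : Fin n → F) j), mem_bchCode.mp (b l).2⟩
  have hv : LinearIndependent K v := by
    rw [Fintype.linearIndependent_iff]
    intro g hg
    let B := Module.Basis.ofVectorSpace F K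
    have hcoord : ∀ s l, B.repr (g l) s = 0 := by
      intro s
      refine Fintype.linearIndependent_iff.mp b.linearIndependent (fun l => B.repr (g l) s) ?_
      ext j
      have hj := congrFun (congrArg Subtype.val hg) j
      simp only [v, Submodule.coe_sum, Submodule.coe_smul, Finset.sum_apply, Pi.smul_apply,
        smul_eq_mul, ZeroMemClass.coe_zero, Pi.zero_apply] at hj ⊢
      have hs := congrArg (fun x => B.repr x s) hj
      simp only [fun l => mul_comm (g l), ← Algebra.smul_def, map_sum, map_smul, map_zero,
        Finsupp.coe_finsetSum, Finset.sum_apply, Finsupp.smul_apply, smul_eq_mul,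
        Finsupp.zero_apply] at hs
      rw [← hs]
      exact Finset.sum_congr rfl fun l _ => mul_comm _ _
    intro l
    refine B.repr.map_eq_zero_iff.mp (Finsupp.ext fun s => ?_)
    rw [hcoord, Finsupp.zero_apply]
  have h1 := hv.fintype_card_le_finrank
  rw [Fintype.card_fin] at h1
  refine h1.trans ?_
  have h2 : rsCode P Δ = Submodule.span K
      ((Δ.image fun (i : ℕ) (j : Fin n) => P j ^ i : Finset (Fin n → K)) : Set (Fin n → K)) := by
    rw [rsCode, Finset.coe_image]
  rw [h2]
  exact (finrank_span_finset_le_card _).trans Finset.card_image_le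

/-- A vector that is orthogonal to `D` consecutive powers of distinct points and has at most `D`
nonzero entries vanishes. -/
theorem eq_zero_of_sum_mul_pow_eq_zero {P : Fin n → K} (hP : Function.Injective P) {D : ℕ}
    {y : Fin n → K} (hy : ∀ i < D, ∑ j, y j * P j ^ i = 0) {S : Finset (Fin n)} (hS : S.card ≤ D)
    (hyS : ∀ j ∉ S, y j = 0) : y = 0 := by
  classical
  ext l
  by_cases hl : l ∈ S
  swap
  · exact hyS l hl
  -- This polynomial vanishes at every point of `S` except `P l`, so pairing it with `y` isolates `y
  -- l`.
  let p : Polynomial K := ∏ j ∈ S.erase l, (Polynomial.X - Polynomial.C (P j))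
  have hdeg : p.natDegree < D := by
    rw [Polynomial.natDegree_prod_of_monic _ _ fun j _ => Polynomial.monic_X_sub_C _]
    simp only [Polynomial.natDegree_X_sub_C, Finset.sum_const, smul_eq_mul, mul_one]
    exact (Finset.card_erase_lt_of_mem hl).trans_le hS
  have hsum : ∑ j, y j * p.eval (P j) = 0 := by
    simp only [Polynomial.eval_eq_sum_range' hdeg, Finset.mul_sum]
    rw [Finset.sum_comm]
    refine Finset.sum_eq_zero fun i hi => ?_
    rw [← mul_zero (p.coeff i), ← hy i (Finset.mem_range.mp hi), Finset.mul_sum]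
    exact Finset.sum_congr rfl fun j _ => by ring
  rw [Finset.sum_eq_single l] at hsum
  · refine (mul_eq_zero.mp hsum).resolve_right ?_
    rw [Polynomial.eval_prod]
    refine Finset.prod_ne_zero_iff.mpr fun j hj => ?_
    simp only [Polynomial.eval_sub, Polynomial.eval_X, Polynomial.eval_C, ne_eq, sub_eq_zero]
    exact fun h => (Finset.ne_of_mem_erase hj) (hP h).symm
  · intro j _ hj
    by_cases hjS : j ∈ S
    · rw [Polynomial.eval_prod, Finset.prod_eq_zero (Finset.mem_erase.mpr ⟨hj, hjS⟩) (by simp),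
        mul_zero]
    · rw [hyS j hjS, zero_mul]
  · simp

variable [Fintype K]

theorem card_units_eq (e : Fin n ≃ Kˣ) : n = Fintype.card K - 1 := by
  classical
  rw [← Fintype.card_units, ← Fintype.card_congr e, Fintype.card_fin]

theorem unit_pow_mod (e : Fin n ≃ Kˣ) (u : Kˣ) (i : ℕ) : (u : K) ^ (i % n) = (u : K) ^ i := by
  have h : (u : K) ^ n = 1 := by
    rw [card_units_eq e]
    exact FiniteField.pow_card_sub_one_eq_one _ u.ne_zero
  exact (pow_eq_pow_mod i h).symm

theorem sum_pow_points (e : Fin n ≃ Kˣ) (i : ℕ) :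
    ∑ j, (e j : K) ^ i = if n ∣ i then -1 else 0 := by
  classical
  rw [Equiv.sum_comp e fun u : Kˣ => (u : K) ^ i, FiniteField.sum_pow_units, ← card_units_eq e]

/-- The code `D_Δ` consists of the vectors whose Fourier coefficients vanish outside `Δ`. -/
theorem mem_rsCode_iff (e : Fin n ≃ Kˣ) {Δ : Finset ℕ} (hΔ : Δ ⊆ Finset.range n)
    {x : Fin n → K} : x ∈ rsCode (fun j => (e j : K)) Δ ↔
      ∀ i < n, i ∉ Δ → ∑ j, x j * (e j : K) ^ (n - i) = 0 := by
  constructor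
  · intro hx i hi hiΔ
    refine Submodule.span_induction (p := fun x _ => ∑ j, x j * (e j : K) ^ (n - i) = 0)
      ?_ ?_ ?_ ?_ hx
    · rintro _ ⟨l, hl, rfl⟩
      simp only [← pow_add, sum_pow_points e]
      refine if_neg fun hdvd => hiΔ ?_
      have hln : l < n := Finset.mem_range.mp (hΔ hl)
      obtain ⟨m, hm⟩ := hdvd
      have hm1 : m = 1 := by
        have h0 : 0 < m := Nat.pos_of_ne_zero (by rintro rfl; omega)
        have h2 : m < 2 := by
          by_contra! h
          have := Nat.mul_le_mul_left n h
          omega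
        omega
      subst hm1
      have : l = i := by omega
      exact this ▸ hl
    · simp
    · intro a b _ _ ha hb
      simp [add_mul, Finset.sum_add_distrib, ha, hb]
    · intro r a _ ha
      simp only [Pi.smul_apply, smul_eq_mul, mul_assoc]
      rw [← Finset.mul_sum, ha, mul_zero]
  · intro h
    -- Fourier inversion; the sign appears because `n = #K - 1` equals `-1` in `K`.
    have hinv : -x = ∑ i ∈ Finset.range n,
        (∑ j, x j * (e j : K) ^ (n - i)) • fun j => (e j : K) ^ i := by
      ext l
      simp only [Finset.sum_apply, Pi.smul_apply, smul_eq_mul, Finset.sum_mul]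
      rw [Finset.sum_comm, Finset.sum_eq_single l]
      · rw [Finset.sum_congr rfl (g := fun _ => x l)]
        · have hn : (n : K) = -1 := by
            rw [card_units_eq e, Nat.cast_sub Fintype.card_pos, Nat.cast_card_eq_zero]
            simp
          simp [hn]
        · intro i hi
          rw [mul_assoc, ← pow_add, Nat.sub_add_cancel (Finset.mem_range.mp hi).le,
            ← unit_pow_mod e, Nat.mod_self, pow_zero, mul_one]
      · intro j _ hjl
        have hterm : ∀ i ∈ Finset.range n, x j * (e j : K) ^ (n - i) * (e l : K) ^ i =
            x j * ((e l : K) / (e j : K)) ^ i := by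
          intro i hi
          have hj : (e j : K) ≠ 0 := (e j).ne_zero
          have h1 : (e j : K) ^ (n - i) * (e j : K) ^ i = 1 := by
            rw [← pow_add, Nat.sub_add_cancel (Finset.mem_range.mp hi).le,
              ← unit_pow_mod e, Nat.mod_self, pow_zero]
          rw [div_pow, mul_assoc, eq_inv_of_mul_eq_one_left h1, div_eq_inv_mul]
        rw [Finset.sum_congr rfl hterm, ← Finset.mul_sum, geom_sum_eq, div_pow,
          ← unit_pow_mod e, ← unit_pow_mod e (e j)]
        · simp
        · rw [Ne, div_eq_one_iff_eq (e j).ne_zero, ← Units.ext_iff]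
          exact fun h => hjl (e.injective h).symm
      · simp
    rw [← neg_neg x, hinv]
    refine Submodule.neg_mem _ (Submodule.sum_mem _ fun i hi => ?_)
    by_cases hiΔ : i ∈ Δ
    · exact Submodule.smul_mem _ _ (pow_mem_rsCode _ hiΔ)
    · rw [h i (Finset.mem_range.mp hi) hiΔ, zero_smul]
      exact Submodule.zero_mem _

/-- This is Delsarte duality. Closure of `Δ` under multiplication by `q` puts all Frobenius
conjugates of an evaluation vector in `D_Δ`, so traces of its multiples are words of `E_Δ`.
Nondegeneracy of the trace form then turns orthogonality over `F` into one equation over `K`. -/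
theorem mem_euclideanDual_bchCode_iff [Fintype F] (e : Fin n ≃ Kˣ) {Δ : Finset ℕ}
    (hΔ : Δ ⊆ Finset.range n) (hq : ∀ i ∈ Δ, i * Fintype.card F % n ∈ Δ) {y : Fin n → F} :
    y ∈ euclideanDual (bchCode F (fun j => (e j : K)) Δ) ↔
      ∀ i ∈ Δ, ∑ j, algebraMap F K (y j) * (e j : K) ^ i = 0 := by
  constructor
  · intro hy i hi
    have hfrob : ∀ s : ℕ, (fun j => (e j : K) ^ (i * Fintype.card F ^ s)) ∈
        rsCode (fun j => (e j : K)) Δ := by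
      suffices ∀ s : ℕ, i * Fintype.card F ^ s % n ∈ Δ by
        intro s
        convert pow_mem_rsCode (fun j => (e j : K)) (this s) using 2
        rw [unit_pow_mod e]
      intro s
      induction s with
      | zero =>
        rw [pow_zero, mul_one, Nat.mod_eq_of_lt (Finset.mem_range.mp (hΔ hi))]
        exact hi
      | succ s ih =>
        rw [pow_succ, ← mul_assoc, ← Nat.mod_mul_mod]
        exact hq _ ih
    have htr : ∀ a : K, Algebra.trace F K (a * ∑ j, algebraMap F K (y j) * (e j : K) ^ i) = 0 := by
      intro a
      have hmem : (fun j => Algebra.trace F K (a * (e j : K) ^ i)) ∈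
          bchCode F (fun j => (e j : K)) Δ := by
        rw [mem_bchCode]
        have : (fun j => algebraMap F K (Algebra.trace F K (a * (e j : K) ^ i))) =
            ∑ s ∈ Finset.range (Module.finrank F K), a ^ (Nat.card F ^ s) •
              fun j => (e j : K) ^ (i * Fintype.card F ^ s) := by
          ext j
          rw [FiniteField.algebraMap_trace_eq_sum_pow]
          simp [mul_pow, pow_mul]
        rw [this]
        exact Submodule.sum_mem _ fun s _ => Submodule.smul_mem _ _ (hfrob s)
      rw [← hy _ hmem, Finset.mul_sum, map_sum, dotProduct]
      refine Finset.sum_congr rfl fun j _ => ?_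
      rw [mul_left_comm, ← Algebra.smul_def, map_smul, smul_eq_mul, mul_comm]
    refine (traceForm_nondegenerate F K).1 _ fun a => ?_
    rw [Algebra.traceForm_apply, mul_comm]
    exact htr a
  · intro hy x hx
    apply FaithfulSMul.algebraMap_injective F K
    rw [map_zero, dotProduct, map_sum]
    simp only [map_mul]
    refine Submodule.span_induction
      (p := fun x _ => ∑ j, x j * algebraMap F K (y j) = 0) ?_ ?_ ?_ ?_ (mem_bchCode.mp hx)
    · rintro _ ⟨i, hi, rfl⟩
      simpa [mul_comm] using hy i hi
    · simp
    · intro a b _ _ ha hb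
      simp [add_mul, Finset.sum_add_distrib, ha, hb]
    · intro r a _ ha
      simp only [Pi.smul_apply, smul_eq_mul, mul_assoc]
      rw [← Finset.mul_sum, ha, mul_zero]

/-- The set of the exponents `-i`, `i ∈ Δ`, modulo `n`. -/
def negExponents (n : ℕ) (Δ : Finset ℕ) : Finset ℕ :=
  (Finset.range n).filter fun i => (n - i) % n ∈ Δ

theorem neg_mod_neg_mod {n i : ℕ} (hi : i < n) : (n - (n - i) % n) % n = i := by
  rcases Nat.eq_zero_or_pos i with rfl | h0
  · simp
  · rw [Nat.mod_eq_of_lt (by omega : n - i < n), Nat.sub_sub_self hi.le, Nat.mod_eq_of_lt hi]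

theorem card_negExponents {Δ : Finset ℕ} (hΔ : Δ ⊆ Finset.range n) :
    (negExponents n Δ).card = Δ.card := by
  refine Finset.card_bij' (fun i _ => (n - i) % n) (fun i _ => (n - i) % n) ?_ ?_ ?_ ?_
  · intro i hi
    exact (Finset.mem_filter.mp hi).2
  · intro i hi
    have hin := Finset.mem_range.mp (hΔ hi)
    rw [negExponents, Finset.mem_filter, neg_mod_neg_mod hin]
    exact ⟨Finset.mem_range.mpr (Nat.mod_lt _ (by omega)), hi⟩
  · intro i hi
    exact neg_mod_neg_mod (Finset.mem_range.mp (Finset.mem_filter.mp hi).1)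
  · intro i hi
    exact neg_mod_neg_mod (Finset.mem_range.mp (hΔ hi))

theorem euclideanDual_bchCode [Fintype F] (e : Fin n ≃ Kˣ) {Δ : Finset ℕ}
    (hΔ : Δ ⊆ Finset.range n) (hq : ∀ i ∈ Δ, i * Fintype.card F % n ∈ Δ) :
    euclideanDual (bchCode F (fun j => (e j : K)) Δ) =
      bchCode F (fun j => (e j : K)) (Finset.range n \ negExponents n Δ) := by
  ext y
  rw [mem_euclideanDual_bchCode_iff e hΔ hq, mem_bchCode, mem_rsCode_iff e Finset.sdiff_subset]
  constructor
  · intro h i hi hiΔ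
    rw [← h ((n - i) % n)]
    · simp only [unit_pow_mod e]
    · by_contra hmem
      exact hiΔ (by simp [negExponents, hi, hmem])
  · intro h i hi
    have hin := Finset.mem_range.mp (hΔ hi)
    rw [← h ((n - i) % n) (Nat.mod_lt _ (by omega))]
    · refine Finset.sum_congr rfl fun j _ => ?_
      rw [← unit_pow_mod e (e j) (n - _), neg_mod_neg_mod hin]
    · simp [negExponents, neg_mod_neg_mod hin, hi, Nat.mod_lt _ (show 0 < n by omega)]

/-- The upper bounds for the code and for its dual add up to `n`, which is also the sum of the two
dimensions, so both are equalities. -/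
theorem finrank_bchCode [Fintype F] (e : Fin n ≃ Kˣ) {Δ : Finset ℕ}
    (hΔ : Δ ⊆ Finset.range n) (hq : ∀ i ∈ Δ, i * Fintype.card F % n ∈ Δ) :
    Module.finrank F (bchCode F (fun j => (e j : K)) Δ) = Δ.card := by
  have h1 := finrank_add_finrank_euclideanDual (bchCode F (fun j => (e j : K)) Δ)
  rw [euclideanDual_bchCode e hΔ hq] at h1
  have h2 := finrank_bchCode_le (F := F) (fun j => (e j : K)) Δ
  have h3 := finrank_bchCode_le (F := F) (fun j => (e j : K)) (Finset.range n \ negExponents n Δ)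
  have h4 : negExponents n Δ ⊆ Finset.range n := Finset.filter_subset _ _
  have h5 := Finset.card_le_card h4
  rw [Finset.card_sdiff_of_subset h4, Finset.card_range, card_negExponents hΔ] at h3
  rw [card_negExponents hΔ, Finset.card_range] at h5
  omega

theorem bchCode_inf_euclideanDual [Fintype F] (e : Fin n ≃ Kˣ) {Δ : Finset ℕ}
    (hΔ : Δ ⊆ Finset.range n) (hq : ∀ i ∈ Δ, i * Fintype.card F % n ∈ Δ) :
    bchCode F (fun j => (e j : K)) Δ ⊓ euclideanDual (bchCode F (fun j => (e j : K)) Δ) =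
      bchCode F (fun j => (e j : K)) (Δ \ negExponents n Δ) := by
  rw [euclideanDual_bchCode e hΔ hq]
  ext y
  rw [Submodule.mem_inf, mem_bchCode, mem_bchCode, mem_bchCode, mem_rsCode_iff e hΔ,
    mem_rsCode_iff e Finset.sdiff_subset, mem_rsCode_iff e (Finset.sdiff_subset.trans hΔ)]
  constructor
  · rintro ⟨h1, h2⟩ i hi hiΔ
    by_cases h : i ∈ Δ
    · refine h2 i hi fun h' => hiΔ ?_
      exact Finset.mem_sdiff.mpr ⟨h, (Finset.mem_sdiff.mp h').2⟩
    · exact h1 i hi h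
  · intro h
    exact ⟨fun i hi hiΔ => h i hi fun h' => hiΔ (Finset.mem_sdiff.mp h').1,
      fun i hi hiΔ => h i hi fun h' => hiΔ (Finset.mem_sdiff.mpr
        ⟨Finset.mem_range.mpr hi, (Finset.mem_sdiff.mp h').2⟩)⟩

end BCH

/-! ### Cyclotomic cosets modulo `q ^ 2 - 1` -/

section Cosets

variable {n q : ℕ}

theorem mul_mod_mul_mod (hqn : q * q ≡ 1 [MOD n]) {x : ℕ} (hx : x < n) :
    x * q % n * q % n = x := by
  rw [Nat.mod_mul_mod, mul_assoc]
  have := hqn.mul_left x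
  rw [mul_one] at this
  exact Eq.trans this (Nat.mod_eq_of_lt hx)

/-- Since `q ^ 2 ≡ 1`, multiplication by `q` is an involution and cosets have at most two elements.
-/
theorem mem_cyclotomicCoset (hqn : q * q ≡ 1 [MOD n]) {x y : ℕ} (hx : x < n) :
    y ∈ cyclotomicCoset n q x ↔ y = x ∨ y = x * q % n := by
  classical
  rw [cyclotomicCoset, Finset.mem_filter, Finset.mem_range]
  constructor
  · rintro ⟨hy, s, hs⟩
    have hs' : y = x * q ^ s % n := (Nat.mod_eq_of_lt hy).symm.trans hs
    have key : x * q ^ s % n = x ∨ x * q ^ s % n = x * q % n := by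
      clear hs hs'
      induction s with
      | zero => left; rw [pow_zero, mul_one, Nat.mod_eq_of_lt hx]
      | succ s ih =>
        rw [pow_succ, ← mul_assoc, ← Nat.mod_mul_mod]
        rcases ih with h | h <;> rw [h]
        · exact Or.inr rfl
        · exact Or.inl (mul_mod_mul_mod hqn hx)
    rcases key with h | h
    · exact Or.inl (hs'.trans h)
    · exact Or.inr (hs'.trans h)
  · rintro (rfl | rfl)
    · exact ⟨hx, 0, by rw [pow_zero, mul_one]⟩
    · exact ⟨Nat.mod_lt _ (by omega), 1, by rw [pow_one]; exact Nat.mod_modEq _ _⟩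

theorem mem_minimalReps (hqn : q * q ≡ 1 [MOD n]) {x : ℕ} :
    x ∈ minimalReps n q ↔ x < n ∧ x ≤ x * q % n := by
  rw [minimalReps, Finset.mem_filter, Finset.mem_range]
  refine and_congr_right fun hx => ?_
  simp [mem_cyclotomicCoset hqn hx]

theorem minimalReps_finite (n q : ℕ) : (Set.ofPred fun x => x ∈ minimalReps n q).Finite :=
  (minimalReps n q).finite_toSet

theorem card_minimalReps (n q : ℕ) :
    (minimalReps_finite n q).toFinset.card = (minimalReps n q).card := by
  congr 1
  ext x
  simp

theorem minimalRep_mem {j : ℕ} (hj : j < (minimalReps n q).card) :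
    minimalRep n q j ∈ minimalReps n q :=
  Nat.nth_mem_of_lt_card (minimalReps_finite n q) (by rwa [card_minimalReps])

theorem minimalRep_le {i j : ℕ} (hij : i ≤ j) (hj : j < (minimalReps n q).card) :
    minimalRep n q i ≤ minimalRep n q j :=
  Nat.nth_le_nth_of_lt_card (minimalReps_finite n q) hij (by rwa [card_minimalReps])

theorem minimalRep_lt {i j : ℕ} (hij : i < j) (hj : j < (minimalReps n q).card) :
    minimalRep n q i < minimalRep n q j :=
  Nat.nth_lt_nth_of_lt_card (minimalReps_finite n q) hij (by rwa [card_minimalReps])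

theorem exists_minimalRep_eq {x : ℕ} (hx : x ∈ minimalReps n q) :
    ∃ j < (minimalReps n q).card, minimalRep n q j = x := by
  rw [← card_minimalReps]
  exact Nat.exists_lt_card_finite_nth_eq (minimalReps_finite n q) hx

theorem min_mem_minimalReps (hqn : q * q ≡ 1 [MOD n]) {x : ℕ} (hx : x < n) :
    min x (x * q % n) ∈ minimalReps n q := by
  rw [mem_minimalReps hqn]
  have h := mul_mod_mul_mod hqn hx
  have h' : x * q % n < n := Nat.mod_lt _ (by omega)
  rcases le_total x (x * q % n) with hle | hle
  · rw [min_eq_left hle]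
    exact ⟨hx, hle⟩
  · rw [min_eq_right hle, h]
    exact ⟨h', hle⟩

theorem min_eq_of_mem_cyclotomicCoset (hqn : q * q ≡ 1 [MOD n]) {x y : ℕ}
    (hx : x ∈ minimalReps n q) (hy : y ∈ cyclotomicCoset n q x) :
    y < n ∧ min y (y * q % n) = x := by
  rw [mem_minimalReps hqn] at hx
  rcases (mem_cyclotomicCoset hqn hx.1).mp hy with rfl | rfl
  · exact ⟨hx.1, min_eq_left hx.2⟩
  · exact ⟨Nat.mod_lt _ (by omega), by rw [mul_mod_mul_mod hqn hx.1, min_eq_right hx.2]⟩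

theorem mem_consecutiveCosets (hqn : q * q ≡ 1 [MOD n]) {t : ℕ}
    (ht : t < (minimalReps n q).card) {x : ℕ} :
    x ∈ consecutiveCosets n q t ↔ x < n ∧ min x (x * q % n) ≤ minimalRep n q t := by
  simp only [consecutiveCosets, Finset.mem_biUnion, Finset.mem_range]
  constructor
  · rintro ⟨j, hj, hx⟩
    obtain ⟨h1, h2⟩ := min_eq_of_mem_cyclotomicCoset hqn (minimalRep_mem (by omega)) hx
    exact ⟨h1, h2.trans_le (minimalRep_le (by omega) ht)⟩
  · rintro ⟨hx, hle⟩
    obtain ⟨j, hj, hje⟩ := exists_minimalRep_eq (min_mem_minimalReps hqn hx)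
    have hjt : j < t + 1 := by
      by_contra! h
      have := minimalRep_lt (n := n) (q := q) (show t < j by omega) hj
      omega
    refine ⟨j, hjt, ?_⟩
    rw [mem_cyclotomicCoset hqn ((mem_minimalReps hqn).mp (minimalRep_mem hj)).1, hje]
    rcases le_total x (x * q % n) with h | h
    · left; rw [min_eq_left h]
    · right; rw [min_eq_right h, mul_mod_mul_mod hqn hx]

theorem card_consecutiveCosets (hqn : q * q ≡ 1 [MOD n]) {t : ℕ}
    (ht : t < (minimalReps n q).card) :
    (consecutiveCosets n q t).card =
      ∑ j ∈ Finset.range (t + 1), (cyclotomicCoset n q (minimalRep n q j)).card := by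
  refine Finset.card_biUnion fun i hi j hj hij => Finset.disjoint_left.mpr fun y hyi hyj => ?_
  simp only [Finset.coe_range, Set.mem_Iio] at hi hj
  have h1 := (min_eq_of_mem_cyclotomicCoset hqn (minimalRep_mem (by omega)) hyi).2
  have h2 := (min_eq_of_mem_cyclotomicCoset hqn (minimalRep_mem (by omega)) hyj).2
  rcases lt_or_gt_of_ne hij with h | h
  · have := minimalRep_lt (n := n) (q := q) h (by omega)
    omega
  · have := minimalRep_lt (n := n) (q := q) h (by omega)
    omega

/-- The least conjugate of `x` is at most `x`, and no minimal representative lies strictly between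
`m_t` and `m_{t+1}`. This supplies the consecutive exponents of the BCH bound. -/
theorem mem_consecutiveCosets_of_lt (hqn : q * q ≡ 1 [MOD n]) {t : ℕ}
    (ht : t + 1 < (minimalReps n q).card) {x : ℕ} (hx : x < minimalRep n q (t + 1)) :
    x ∈ consecutiveCosets n q t := by
  have hxn : x < n := hx.trans ((mem_minimalReps hqn).mp (minimalRep_mem ht)).1
  rw [mem_consecutiveCosets hqn (by omega)]
  exact ⟨hxn, Nat.le_nth_of_lt_nth_succ ((min_le_left _ _).trans_lt hx)
    (min_mem_minimalReps hqn hxn)⟩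

theorem mul_mod_mem_consecutiveCosets (hqn : q * q ≡ 1 [MOD n]) {t : ℕ}
    (ht : t < (minimalReps n q).card) {x : ℕ} (hx : x ∈ consecutiveCosets n q t) :
    x * q % n ∈ consecutiveCosets n q t := by
  rw [mem_consecutiveCosets hqn ht] at hx ⊢
  rw [mul_mod_mul_mod hqn hx.1, min_comm]
  exact ⟨Nat.mod_lt _ (by omega), hx.2⟩

theorem mul_mod_mem_negExponents {Δ : Finset ℕ} (hq : ∀ i ∈ Δ, i * q % n ∈ Δ) {i : ℕ}
    (hi : i ∈ negExponents n Δ) : i * q % n ∈ negExponents n Δ := by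
  rw [negExponents, Finset.mem_filter, Finset.mem_range] at hi ⊢
  have hpos : 0 < n := by omega
  refine ⟨Nat.mod_lt _ hpos, ?_⟩
  have : (n - i * q % n) % n = (n - i) % n * q % n := by
    have h1 : i * q % n + (n - i * q % n) ≡ 0 [MOD n] := by
      rw [Nat.add_sub_cancel' (Nat.mod_lt _ hpos).le]
      simp [Nat.ModEq]
    have h2 : i * q % n + (n - i) % n * q ≡ 0 [MOD n] := by
      have h3 : i * q % n + (n - i) % n * q ≡ i * q + (n - i) * q [MOD n] :=
        (Nat.mod_modEq _ _).add ((Nat.mod_modEq _ _).mul_right _)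
      rw [← add_mul, Nat.add_sub_cancel' hi.1.le] at h3
      exact h3.trans (by simp [Nat.ModEq])
    exact Nat.ModEq.add_left_cancel' _ (h1.trans h2.symm)
  rw [this]
  exact hq _ hi.2

theorem mul_mod_mem_sdiff_negExponents (hqn : q * q ≡ 1 [MOD n]) {Δ : Finset ℕ}
    (hΔ : Δ ⊆ Finset.range n) (hq : ∀ i ∈ Δ, i * q % n ∈ Δ) {i : ℕ}
    (hi : i ∈ Δ \ negExponents n Δ) : i * q % n ∈ Δ \ negExponents n Δ := by
  rw [Finset.mem_sdiff] at hi ⊢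
  refine ⟨hq _ hi.1, fun h => hi.2 ?_⟩
  have := mul_mod_mem_negExponents hq h
  rwa [mul_mod_mul_mod hqn (Finset.mem_range.mp (hΔ hi.1))] at this

end Cosets

/-! ### Counting the exponents `i ∈ Δ` with `-i ∈ Δ` -/

section Counting

theorem sum_range_ite_add_lt (b r : ℕ) :
    ∑ u ∈ Finset.range b, (if b + u < r then 1 else 0) = min b (r - b) := by
  rw [← Finset.card_filter, ← Finset.card_range (min b (r - b))]
  congr 1
  ext u
  simp only [Finset.mem_filter, Finset.mem_range]
  omega

/-- The omitted pairs of the `b × b` square form a corner triangle with side `2b - q` when this is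
positive. The induction adds one row and one column. -/
theorem two_mul_sum_ite_add_lt {q b : ℕ} (hb : b < q) :
    2 * ((∑ l ∈ Finset.range b, ∑ u ∈ Finset.range b, if l + u < q - 1 then 1 else 0 : ℕ) : ℤ) =
      2 * (b : ℤ) ^ 2 - if 2 * b ≤ q then 0 else (2 * (b : ℤ) - q) * (2 * (b : ℤ) - q + 1) := by
  induction b with
  | zero => simp
  | succ b ih =>
    have ih := ih (by omega)
    have hstep : ∑ l ∈ Finset.range (b + 1), ∑ u ∈ Finset.range (b + 1),
        (if l + u < q - 1 then 1 else 0) =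
        (∑ l ∈ Finset.range b, ∑ u ∈ Finset.range b, if l + u < q - 1 then 1 else 0) +
          2 * min b (q - 1 - b) + if 2 * b < q - 1 then 1 else 0 := by
      have h2 : ∑ l ∈ Finset.range b, (if l + b < q - 1 then 1 else 0) = min b (q - 1 - b) := by
        simp only [add_comm _ b, sum_range_ite_add_lt]
      rw [Finset.sum_range_succ, Finset.sum_range_succ]
      simp only [Finset.sum_range_succ, Finset.sum_add_distrib, h2, sum_range_ite_add_lt]
      rw [← two_mul b]
      ring
    rw [hstep, Nat.cast_add, Nat.cast_add, mul_add, mul_add, ih]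
    push_cast
    rcases lt_trichotomy (2 * b + 1) q with h | h | h
    · rw [if_pos (by omega), if_pos (by omega), if_pos (by omega), min_eq_left (by omega)]
      ring
    · rw [if_pos (by omega), if_neg (by omega), if_neg (by omega), min_eq_left (by omega)]
      obtain rfl : q = 2 * b + 1 := h.symm
      push_cast
      ring
    · have hmin : min (b : ℤ) ((q - 1 - b : ℕ) : ℤ) = q - 1 - b := by omega
      rw [if_neg (c := 2 * (b + 1) ≤ q) (by omega), if_neg (c := 2 * b < q - 1) (by omega), hmin]
      split_ifs with h2
      · obtain rfl : q = 2 * b := by omega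
        push_cast
        ring
      · ring

/-- Pairs `(l, u)` of a lower digit and a complemented upper digit, such that both an exponent and
its negative do not exceed `b₀ + b₁ q`. -/
theorem sum_digits {q b₀ b₁ : ℕ} (hb₀ : b₀ < q) (hb₁ : b₁ + 1 < q) :
    ∑ l ∈ Finset.range q, ∑ u ∈ Finset.range q,
      (if l + u < q - 1 ∧ (l < b₁ ∨ l = b₁ ∧ q - 1 - u ≤ b₀) ∧ (u < b₁ ∨ u = b₁ ∧ q - 1 - l ≤ b₀)
        then 1 else 0) =
      (∑ l ∈ Finset.range b₁, ∑ u ∈ Finset.range b₁, if l + u < q - 1 then 1 else 0) +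
        2 * (min b₁ (q - 1 - b₁) - (q - 1 - b₀)) +
        if 2 * b₁ < q - 1 ∧ q - 1 - b₁ ≤ b₀ then 1 else 0 := by
  have hsub : Finset.range (b₁ + 1) ⊆ Finset.range q := Finset.range_subset_range.mpr hb₁.le
  rw [← Finset.sum_subset hsub]
  swap
  · intro l _ hl
    rw [Finset.mem_range] at hl
    exact Finset.sum_eq_zero fun u _ => if_neg (by omega)
  have hinner : ∀ l, ∑ u ∈ Finset.range q, (if l + u < q - 1 ∧ (l < b₁ ∨ l = b₁ ∧ q - 1 - u ≤ b₀) ∧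
      (u < b₁ ∨ u = b₁ ∧ q - 1 - l ≤ b₀) then 1 else 0) =
      ∑ u ∈ Finset.range (b₁ + 1), if l + u < q - 1 ∧ (l < b₁ ∨ l = b₁ ∧ q - 1 - u ≤ b₀) ∧
      (u < b₁ ∨ u = b₁ ∧ q - 1 - l ≤ b₀) then 1 else 0 := by
    intro l
    refine (Finset.sum_subset hsub fun u _ hu => ?_).symm
    rw [Finset.mem_range] at hu
    exact if_neg (by omega)
  simp only [hinner]
  rw [Finset.sum_range_succ]
  simp only [Finset.sum_range_succ, Finset.sum_add_distrib, lt_irrefl, true_and, false_or]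
  have h1 : ∑ l ∈ Finset.range b₁, ∑ u ∈ Finset.range b₁,
      (if l + u < q - 1 ∧ (l < b₁ ∨ l = b₁ ∧ q - 1 - u ≤ b₀) ∧ (u < b₁ ∨ u = b₁ ∧ q - 1 - l ≤ b₀)
        then 1 else 0) =
      ∑ l ∈ Finset.range b₁, ∑ u ∈ Finset.range b₁, if l + u < q - 1 then 1 else 0 := by
    refine Finset.sum_congr rfl fun l hl => Finset.sum_congr rfl fun u hu => ?_
    rw [Finset.mem_range] at hl hu
    simp [hl, hu]
  -- Each of the two edges `l = b₁` and `u = b₁` leaves an interval for the other digit, starting at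
  -- `q - 1 - b₀`; the corner `l = u = b₁` is counted separately.
  have hI : ∀ f : ℕ → Prop, ∀ [DecidablePred f],
      (∀ u < b₁, f u ↔ u < q - 1 - b₁ ∧ q - 1 - b₀ ≤ u) →
      ∑ u ∈ Finset.range b₁, (if f u then 1 else 0) = min b₁ (q - 1 - b₁) - (q - 1 - b₀) := by
    intro f _ hf
    rw [← Finset.card_filter, ← Nat.card_Ico]
    congr 1
    ext u
    simp only [Finset.mem_filter, Finset.mem_range, Finset.mem_Ico]
    constructor
    · rintro ⟨h, hu⟩
      have := (hf u h).mp hu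
      omega
    · intro h
      exact ⟨by omega, (hf u (by omega)).mpr (by omega)⟩
  rw [h1, hI _ fun l hl => by omega, hI _ fun u hu => by omega]
  rw [if_congr (show b₁ + b₁ < q - 1 ∧ q - 1 - b₁ ≤ b₀ ∧ q - 1 - b₁ ≤ b₀ ↔
    2 * b₁ < q - 1 ∧ q - 1 - b₁ ≤ b₀ by omega) rfl rfl]
  ring

theorem sum_sum_eq_of_symm (q : ℕ) (f : ℕ → ℕ → Prop) [∀ a b, Decidable (f a b)]
    (hf : ∀ a b, f a b ↔ f b a) :
    ∑ a ∈ Finset.range q, ∑ b ∈ Finset.range q, (if f a b then 1 else 0) =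
      2 * (∑ a ∈ Finset.range q, ∑ b ∈ Finset.range q, if a < b ∧ f a b then 1 else 0) +
        ∑ a ∈ Finset.range q, if f a a then 1 else 0 := by
  have h1 : ∑ a ∈ Finset.range q, ∑ b ∈ Finset.range q, (if b < a ∧ f a b then 1 else 0) =
      ∑ a ∈ Finset.range q, ∑ b ∈ Finset.range q, if a < b ∧ f a b then 1 else 0 := by
    rw [Finset.sum_comm]
    simp only [hf]
  have h2 : ∀ a ∈ Finset.range q, (if f a a then 1 else 0) =
      ∑ b ∈ Finset.range q, if a = b ∧ f a b then 1 else 0 := by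
    intro a ha
    rw [Finset.sum_eq_single a]
    · simp
    · intro b _ hb
      simp [hb.symm]
    · exact fun h => absurd ha h
  rw [Finset.sum_congr rfl h2, two_mul]
  nth_rewrite 2 [← h1]
  simp only [← Finset.sum_add_distrib]
  refine Finset.sum_congr rfl fun a _ => Finset.sum_congr rfl fun b _ => ?_
  rcases lt_trichotomy a b with h | rfl | h
  · simp [h, h.not_gt, h.ne]
  · simp
  · simp [h, h.not_gt, h.ne']

end Counting

/-! ### Base-`q` digits modulo `q ^ 2 - 1` -/

section Digits

variable {q : ℕ}

theorem mul_self_modEq_one (hq : 0 < q) : q * q ≡ 1 [MOD q ^ 2 - 1] := by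
  have h : q * q = 1 + (q ^ 2 - 1) * 1 := by
    have : 1 ≤ q ^ 2 := Nat.one_le_pow _ _ hq
    rw [← sq]; omega
  rw [h]
  exact Nat.add_modulus_mul_modEq_iff.mpr rfl

theorem swap_digits {a b : ℕ} (hb : b < q) (hab : b + a * q < q ^ 2 - 1) :
    (a + b * q) * q % (q ^ 2 - 1) = b + a * q := by
  have h : (a + b * q) * q = b + a * q + (q ^ 2 - 1) * b := by
    have h1 : (q ^ 2 - 1) * b + b = q ^ 2 * b := by
      rw [← Nat.succ_mul, Nat.succ_eq_add_one, Nat.sub_add_cancel (Nat.one_le_pow _ _ (by omega))]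
    linear_combination -h1
  rw [h, Nat.add_mul_mod_self_left, Nat.mod_eq_of_lt hab]

theorem digits_lt_iff {a b : ℕ} (ha : a < q) (hb : b < q) :
    a + b * q < q ^ 2 - 1 ↔ ¬ (a = q - 1 ∧ b = q - 1) := by
  obtain ⟨p, rfl⟩ : ∃ p, q = p + 1 := ⟨q - 1, by omega⟩
  have h2 : (p + 1) ^ 2 - 1 = p * (p + 1) + p := by
    rw [Nat.sub_eq_iff_eq_add (Nat.one_le_pow _ _ (by omega))]; ring
  rw [h2, Nat.add_sub_cancel]
  rcases Nat.lt_succ_iff_lt_or_eq.mp hb with h | rfl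
  · have := Nat.mul_le_mul_right (p + 1) h
    rw [Nat.succ_mul] at this
    omega
  · omega

theorem digits_le_iff {a b c d : ℕ} (hb : b < q) (hd : d < q) :
    b + a * q ≤ d + c * q ↔ a < c ∨ a = c ∧ b ≤ d := by
  rcases lt_trichotomy a c with h | rfl | h
  · have := Nat.mul_le_mul_right q h
    rw [Nat.succ_mul] at this
    omega
  · omega
  · have := Nat.mul_le_mul_right q h
    rw [Nat.succ_mul] at this
    omega

theorem min_digits_le_iff {a b b₀ b₁ : ℕ} (hab : a ≤ b) (hb : b < q) (hb₀ : b₀ < q) :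
    min (a + b * q) (b + a * q) ≤ b₀ + b₁ * q ↔ a < b₁ ∨ a = b₁ ∧ b ≤ b₀ := by
  rw [min_eq_right ((digits_le_iff hb (by omega)).mpr (by omega)), digits_le_iff hb hb₀]

theorem neg_digits {a b : ℕ} (ha : a < q) (hb : b < q) (h0 : ¬ (a = 0 ∧ b = 0))
    (hab : a + b * q < q ^ 2 - 1) :
    (q ^ 2 - 1 - (a + b * q)) % (q ^ 2 - 1) = (q - 1 - a) + (q - 1 - b) * q := by
  have hpos : 0 < a + b * q := by
    rcases Nat.eq_zero_or_pos a with h | h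
    · have : 0 < b * q := Nat.mul_pos (by omega) (by omega)
      omega
    · omega
  rw [Nat.mod_eq_of_lt (by omega)]
  obtain ⟨a', rfl⟩ : ∃ a', q = a + a' + 1 := ⟨q - 1 - a, by omega⟩
  have h1 : (a + a' + 1 - 1 - b) * (a + a' + 1) + b * (a + a' + 1) + (a + a') =
      (a + a' + 1) ^ 2 - 1 := by
    rw [← add_mul, Nat.sub_add_cancel (by omega), Nat.add_sub_cancel]
    symm
    rw [Nat.sub_eq_iff_eq_add (Nat.one_le_pow _ _ (by omega))]
    ring
  omega

/-- The number of exponents `i` such that neither `i` nor `-i` has its least conjugate above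
`b₀ + b₁ q`. -/
theorem card_filter_min_le {b₀ b₁ : ℕ} (hb₀ : b₀ < q) (hb₁ : b₁ + 1 < q) (hle : b₁ ≤ b₀) :
    ((Finset.range (q ^ 2 - 1)).filter fun x =>
      min x (x * q % (q ^ 2 - 1)) ≤ b₀ + b₁ * q ∧
      min ((q ^ 2 - 1 - x) % (q ^ 2 - 1)) ((q ^ 2 - 1 - x) % (q ^ 2 - 1) * q % (q ^ 2 - 1))
        ≤ b₀ + b₁ * q).card =
    1 + 2 * ((∑ l ∈ Finset.range b₁, ∑ u ∈ Finset.range b₁, if l + u < q - 1 then 1 else 0) +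
        2 * (min b₁ (q - 1 - b₁) - (q - 1 - b₀)) +
        if 2 * b₁ < q - 1 ∧ q - 1 - b₁ ≤ b₀ then 1 else 0) + (2 * b₁ + 2 - q) := by
  let A : ℕ → ℕ → Prop := fun a b => min (a + b * q) (b + a * q) ≤ b₀ + b₁ * q
  have hA : ∀ a b, A a b ↔ A b a := fun a b => by simp only [A, min_comm]
  have hAle : ∀ {a b}, a ≤ b → b < q → (A a b ↔ a < b₁ ∨ a = b₁ ∧ b ≤ b₀) :=
    fun hab hb => min_digits_le_iff hab hb hb₀
  have hpos : 0 < q ^ 2 - 1 := by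
    have := (digits_lt_iff (q := q) (a := 0) (b := 0) (by omega) (by omega)).mpr (by omega)
    omega
  rw [← sum_digits hb₀ hb₁]
  have hdiag : ∑ a ∈ Finset.range q, (if A a a ∧ A (q - 1 - a) (q - 1 - a) then 1 else 0) =
      2 * b₁ + 2 - q := by
    have : 2 * b₁ + 2 - q = (Finset.Icc (q - 1 - b₁) b₁).card := by rw [Nat.card_Icc]; omega
    rw [this, ← Finset.card_filter]
    congr 1
    ext a
    rw [Finset.mem_filter, Finset.mem_range, Finset.mem_Icc]
    constructor
    · rintro ⟨ha, h⟩
      rw [hAle le_rfl ha, hAle le_rfl (by omega)] at h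
      omega
    · intro h
      have ha : a < q := by omega
      rw [hAle le_rfl ha, hAle le_rfl (by omega)]
      omega
  -- For `a < b` set `l = a` and `u = q - 1 - b`, the smaller digits of the exponent and of its
  -- negative; `a < b` becomes `l + u < q - 1`.
  have hoff : ∑ l ∈ Finset.range q, ∑ u ∈ Finset.range q, (if l + u < q - 1 ∧
      (l < b₁ ∨ l = b₁ ∧ q - 1 - u ≤ b₀) ∧ (u < b₁ ∨ u = b₁ ∧ q - 1 - l ≤ b₀) then 1 else 0) =
      ∑ a ∈ Finset.range q, ∑ b ∈ Finset.range q,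
        if a < b ∧ A a b ∧ A (q - 1 - a) (q - 1 - b) then 1 else 0 := by
    refine Finset.sum_congr rfl fun l hl => ?_
    rw [← Finset.sum_range_reflect]
    refine Finset.sum_congr rfl fun u hu => ?_
    rw [Finset.mem_range] at hl hu
    refine if_congr ?_ rfl rfl
    by_cases h : l < u
    · rw [hAle h.le hu, hA, hAle (by omega) (by omega)]
      have : q - 1 - (q - 1 - u) = u := by omega
      rw [this]
      simp only [h, true_and, show l + (q - 1 - u) < q - 1 by omega]
    · simp only [h, false_and, show ¬ l + (q - 1 - u) < q - 1 by omega]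
  rw [hoff, ← hdiag, add_assoc, ← sum_sum_eq_of_symm q
    (fun a b => A a b ∧ A (q - 1 - a) (q - 1 - b)) fun a b => and_congr (hA _ _) (hA _ _)]
  -- Zero is its own negative, but complementing its digits gives `q ^ 2 - 1`, so it is counted
  -- apart and yields the summand `1`.
  rw [← Finset.insert_erase (Finset.mem_range.mpr hpos), Finset.filter_insert, if_pos,
    Finset.card_insert_of_notMem (by simp), add_comm 1]
  swap
  · simp
  congr 1
  rw [← Finset.sum_product', ← Finset.card_filter]
  have htop : ¬ A (q - 1) (q - 1) := by
    rw [hAle le_rfl (by omega)]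
    omega
  have key : ∀ a b, a < q → b < q → a + b * q < q ^ 2 - 1 → ¬ (a = 0 ∧ b = 0) →
      ((min (a + b * q) ((a + b * q) * q % (q ^ 2 - 1)) ≤ b₀ + b₁ * q ∧
      min ((q ^ 2 - 1 - (a + b * q)) % (q ^ 2 - 1))
        ((q ^ 2 - 1 - (a + b * q)) % (q ^ 2 - 1) * q % (q ^ 2 - 1)) ≤ b₀ + b₁ * q) ↔
      A a b ∧ A (q - 1 - a) (q - 1 - b)) := by
    intro a b ha hb hab h0
    have hne := (digits_lt_iff ha hb).mp hab
    rw [neg_digits ha hb h0 hab, swap_digits hb ((digits_lt_iff hb ha).mpr (by omega)),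
      swap_digits (by omega) ((digits_lt_iff (by omega) (by omega)).mpr (by omega))]
  refine Finset.card_bij' (fun x _ => (x % q, x / q)) (fun p _ => p.1 + p.2 * q) ?_ ?_ ?_ ?_
  · intro x hx
    simp only [Finset.mem_filter, Finset.mem_erase, Finset.mem_range] at hx
    obtain ⟨⟨hx0, hxn⟩, hx⟩ := hx
    have hdiv : x / q < q := by
      rw [Nat.div_lt_iff_lt_mul (by omega), ← sq]
      omega
    have hmod : x % q < q := Nat.mod_lt _ (by omega)
    have hxe : x % q + x / q * q = x := Nat.mod_add_div' x q
    have hk := key _ _ hmod hdiv (by rwa [hxe]) (by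
      rintro ⟨h1, h2⟩
      rw [h1, h2] at hxe
      omega)
    rw [hxe] at hk
    simp only [Finset.mem_filter, Finset.mem_product, Finset.mem_range]
    exact ⟨⟨hmod, hdiv⟩, hk.mp hx⟩
  · rintro ⟨a, b⟩ h
    simp only [Finset.mem_filter, Finset.mem_product, Finset.mem_range] at h
    obtain ⟨⟨ha, hb⟩, h⟩ := h
    have h0 : ¬ (a = 0 ∧ b = 0) := by
      rintro ⟨rfl, rfl⟩
      exact htop h.2
    have hn : a + b * q < q ^ 2 - 1 := by
      rw [digits_lt_iff ha hb]
      rintro ⟨rfl, rfl⟩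
      exact htop h.1
    simp only [Finset.mem_filter, Finset.mem_erase, Finset.mem_range]
    refine ⟨⟨?_, hn⟩, (key a b ha hb hn h0).mpr h⟩
    intro hz
    refine h0 ⟨by omega, ?_⟩
    have : b * q = 0 := by omega
    rcases Nat.mul_eq_zero.mp this with h | h <;> omega
  · intro x _
    exact Nat.mod_add_div' x q
  · rintro ⟨a, b⟩ h
    simp only [Finset.mem_filter, Finset.mem_product, Finset.mem_range] at h
    have hq : 0 < q := by omega
    ext
    · simp [Nat.mod_eq_of_lt h.1.1]
    · simp [Nat.add_mul_div_right _ _ hq, Nat.div_eq_of_lt h.1.1]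

theorem count_eq_formula {b₀ b₁ m : ℕ} (hb₀ : b₀ < q) (hb₁ : b₁ + 1 < q) (hle : b₁ ≤ b₀)
    (hm : m = b₀ + b₁ * q) :
    ((1 + 2 * ((∑ l ∈ Finset.range b₁, ∑ u ∈ Finset.range b₁, if l + u < q - 1 then 1 else 0) +
        2 * (min b₁ (q - 1 - b₁) - (q - 1 - b₀)) +
        if 2 * b₁ < q - 1 ∧ q - 1 - b₁ ≤ b₀ then 1 else 0) + (2 * b₁ + 2 - q) : ℕ) : ℤ) = 1
        + 4 * ((b₁ : ℤ) * (b₁ + 1) / 2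
            - max 0 ((b₁ : ℤ) - ⌈(q : ℚ) / 2⌉) * ((b₁ : ℤ) - ⌊(q : ℚ) / 2⌋)
            + max 0 ((b₀ : ℤ) - max ((q : ℤ) - 1 - b₁) b₁ + 1))
        - 3 * (if Odd q ∧ ((q : ℚ) ^ 2 - 1) / 2 ≤ m then 1 else 0)
        - 2 * max 0 (⌊(m : ℚ) / (q + 1)⌋ - ⌊((q : ℚ) - 1) / 2⌋)
        - 2 * min ⌊(m : ℚ) / (q - 1)⌋ ⌊(q : ℚ) / 2⌋ := by
  have hT := two_mul_sum_ite_add_lt (q := q) (b := b₁) (by omega)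
  generalize (∑ l ∈ Finset.range b₁, ∑ u ∈ Finset.range b₁, if l + u < q - 1 then 1 else 0) = T
    at hT ⊢
  have hq1 : (0 : ℚ) < q + 1 := by positivity
  have hq2 : (0 : ℚ) < (q : ℚ) - 1 := by
    have : (1 : ℚ) < q := by exact_mod_cast (show 1 < q by omega)
    linarith
  have hmQ : (m : ℚ) = b₀ + b₁ * q := by rw [hm]; push_cast; ring
  have hleQ : (b₁ : ℚ) ≤ b₀ := by exact_mod_cast hle
  have hltQ : (b₀ : ℚ) + 1 ≤ q := by exact_mod_cast hb₀
  have hlt₁Q : (b₁ : ℚ) + 2 ≤ q := by exact_mod_cast hb₁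
  have hb₁Q : (0 : ℚ) ≤ b₁ := by positivity
  -- The two floors come from `m = b₁ (q + 1) + (b₀ - b₁) = b₁ (q - 1) + (b₀ + b₁)`.
  have f1 : ⌊(m : ℚ) / (q + 1)⌋ = b₁ := by
    rw [Int.floor_eq_iff, le_div_iff₀ hq1, div_lt_iff₀ hq1, hmQ]
    push_cast
    constructor <;> linarith
  have f2 : ⌊(m : ℚ) / (q - 1)⌋ = b₁ + if q - 1 ≤ b₀ + b₁ then 1 else 0 := by
    rw [Int.floor_eq_iff, le_div_iff₀ hq2, div_lt_iff₀ hq2, hmQ]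
    split_ifs with h
    · have hQ : (q : ℚ) - 1 ≤ b₀ + b₁ := by
        have : (q : ℚ) ≤ b₀ + b₁ + 1 := by exact_mod_cast (show q ≤ b₀ + b₁ + 1 by omega)
        linarith
      push_cast
      constructor <;> linarith
    · have hQ : (b₀ : ℚ) + b₁ < q - 1 := by
        have : (b₀ : ℚ) + b₁ + 1 < q := by exact_mod_cast (show b₀ + b₁ + 1 < q by omega)
        linarith
      push_cast
      constructor <;> linarith
  have hB : (b₁ : ℤ) * (b₁ + 1) / 2 * 2 = b₁ ^ 2 + b₁ := by
    rw [Int.ediv_mul_cancel (Int.even_mul_succ_self (b₁ : ℤ)).two_dvd]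
    ring
  generalize (b₁ : ℤ) * (b₁ + 1) / 2 = B at hB ⊢
  rw [f1, f2]
  rcases Nat.even_or_odd' q with ⟨p, hp | hp⟩
  · have f3 : ⌊(q : ℚ) / 2⌋ = p := by
      rw [Int.floor_eq_iff, hp]; push_cast; constructor <;> linarith
    have f4 : ⌈(q : ℚ) / 2⌉ = p := by
      rw [Int.ceil_eq_iff, hp]; push_cast; constructor <;> linarith
    have f5 : ⌊((q : ℚ) - 1) / 2⌋ = p - 1 := by
      rw [Int.floor_eq_iff, hp]; push_cast; constructor <;> linarith
    rw [f3, f4, f5,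
      if_neg (c := Odd q ∧ ((q : ℚ) ^ 2 - 1) / 2 ≤ m)
        fun h => (Nat.not_odd_iff_even.mpr (hp ▸ even_two_mul p)) h.1]
    subst hp
    have hY : max 0 ((b₁ : ℤ) - p) * ((b₁ : ℤ) - p) = if b₁ ≤ p then 0 else ((b₁ : ℤ) - p) ^ 2 := by
      split_ifs with h
      · rw [max_eq_left (by omega), zero_mul]
      · rw [max_eq_right (by omega), sq]
    rw [hY]
    have hT' : 2 * (T : ℤ) = 2 * (b₁ : ℤ) ^ 2 -
        if b₁ ≤ p then 0 else 4 * ((b₁ : ℤ) - p) ^ 2 + 2 * (b₁ - p) := by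
      rw [hT]
      congr 1
      refine ite_congr (by simp) (fun _ => rfl) fun _ => ?_
      push_cast
      ring
    -- With the quadratic terms abstracted, the identity is piecewise linear.
    generalize ((b₁ : ℤ) - p) ^ 2 = Z at *
    generalize (b₁ : ℤ) ^ 2 = X at *
    clear hT hY f1 f2 f3 f4 f5 hmQ hq1 hq2 hleQ hltQ hlt₁Q hb₁Q hm
    push_cast
    rcases le_or_gt b₁ p with h | h
    · rw [if_pos h] at hT' ⊢
      omega
    · rw [if_neg h.not_ge] at hT' ⊢
      omega
  · have f3 : ⌊(q : ℚ) / 2⌋ = p := by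
      rw [Int.floor_eq_iff, hp]; push_cast; constructor <;> linarith
    have f4 : ⌈(q : ℚ) / 2⌉ = p + 1 := by
      rw [Int.ceil_eq_iff, hp]; push_cast; constructor <;> linarith
    have f5 : ⌊((q : ℚ) - 1) / 2⌋ = p := by
      rw [Int.floor_eq_iff, hp]; push_cast; constructor <;> linarith
    -- Both digits of `(q ^ 2 - 1) / 2` equal `p`, and `b₁ ≤ b₀`, so the leading digit decides.
    have hδ : (Odd q ∧ ((q : ℚ) ^ 2 - 1) / 2 ≤ m) ↔ p ≤ b₁ := by
      have h1 : ((q : ℚ) ^ 2 - 1) / 2 = ((p + p * q : ℕ) : ℚ) := by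
        rw [hp]; push_cast; ring
      rw [h1, hm, Nat.cast_le, digits_le_iff (by omega) hb₀]
      constructor
      · rintro ⟨-, h⟩; omega
      · intro h
        exact ⟨⟨p, hp⟩, by omega⟩
    rw [f3, f4, f5, if_congr hδ rfl rfl]
    subst hp
    have hY : max 0 ((b₁ : ℤ) - (p + 1)) * ((b₁ : ℤ) - p) =
        if b₁ ≤ p then 0 else ((b₁ : ℤ) - (p + 1)) * (b₁ - p) := by
      split_ifs with h
      · rw [max_eq_left (by omega), zero_mul]
      · rw [max_eq_right (by omega)]
    rw [hY]
    have hT' : 2 * (T : ℤ) = 2 * (b₁ : ℤ) ^ 2 -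
        if b₁ ≤ p then 0 else 4 * (((b₁ : ℤ) - (p + 1)) * (b₁ - p)) + 2 * (b₁ - p) := by
      rw [hT]
      congr 1
      refine ite_congr (by simp; omega) (fun _ => rfl) fun _ => ?_
      push_cast
      ring
    generalize ((b₁ : ℤ) - (p + 1)) * (b₁ - p) = Z at *
    generalize (b₁ : ℤ) ^ 2 = X at *
    clear hT hY f1 f2 f3 f4 f5 hmQ hq1 hq2 hleQ hltQ hlt₁Q hb₁Q hm hδ
    push_cast
    rcases le_or_gt b₁ p with h | h
    · rw [if_pos h] at hT' ⊢
      omega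
    · rw [if_neg h.not_ge] at hT' ⊢
      omega

end Digits

/-- An enumeration of the roots of unity of order `#K - 1` is an enumeration of the units. -/
theorem exists_equiv_units {K : Type*} [Field K] [Fintype K] {n : ℕ} (hn : n = Fintype.card K - 1)
    (P : Fin n ≃ {x : K // x ^ n = 1}) : ∃ e : Fin n ≃ Kˣ, ∀ j, (e j : K) = P j := by
  classical
  have hn0 : n ≠ 0 := by have := Fintype.one_lt_card (α := K); omega
  have h : ∀ x : K, x ^ n = 1 ↔ x ≠ 0 := by
    intro x
    constructor
    · rintro hx rfl
      rw [zero_pow hn0] at hx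
      exact zero_ne_one hx
    · intro hx
      rw [hn]
      exact FiniteField.pow_card_sub_one_eq_one x hx
  exact ⟨P.trans ((Equiv.subtypeEquivRight h).trans unitsEquivNeZero.symm), fun j => rfl⟩

/-! ### The parameters of the code -/

theorem mainTheorem3 {F K : Type*} [Field F] [Fintype F] [DecidableEq F] [Field K] [Algebra F K]
    (hdeg : Module.finrank F K = 2)
    (q : ℕ) (hq : Fintype.card F = q)
    -- an enumeration of the zero locus of `X ^ (q ^ 2 - 1) - 1` in `K`
    (P : Fin (q ^ 2 - 1) ≃ {x : K // x ^ (q ^ 2 - 1) = 1})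
    (t : ℕ) (ht : t + 1 < (minimalReps (q ^ 2 - 1) q).card)
    (m b₀ b₁ : ℕ) (hm : minimalRep (q ^ 2 - 1) q t = m)
    (hb₀ : b₀ < q) (hb₁ : b₁ < q) (hb : m = b₀ + b₁ * q)
    (E : Submodule F (Fin (q ^ 2 - 1) → F))
    (hE : E = bchCode F (fun j => (P j : K)) (consecutiveCosets (q ^ 2 - 1) q t)) :
    ∃ k c : ℕ,
      (c : ℤ) = Module.finrank F E - Module.finrank F ↥(E ⊓ euclideanDual E) ∧
      (c : ℤ) = 1
        + 4 * ((b₁ : ℤ) * (b₁ + 1) / 2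
            - max 0 ((b₁ : ℤ) - ⌈(q : ℚ) / 2⌉) * ((b₁ : ℤ) - ⌊(q : ℚ) / 2⌋)
            + max 0 ((b₀ : ℤ) - max ((q : ℤ) - 1 - b₁) b₁ + 1))
        - 3 * (if Odd q ∧ ((q : ℚ) ^ 2 - 1) / 2 ≤ m then 1 else 0)
        - 2 * max 0 (⌊(m : ℚ) / (q + 1)⌋ - ⌊((q : ℚ) - 1) / 2⌋)
        - 2 * min ⌊(m : ℚ) / (q - 1)⌋ ⌊(q : ℚ) / 2⌋ ∧
      (k : ℤ) = (q : ℤ) ^ 2 - 1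
        - 2 * ∑ j ∈ Finset.range (t + 1),
            ((cyclotomicCoset (q ^ 2 - 1) q (minimalRep (q ^ 2 - 1) q j)).card : ℤ)
        + c ∧
      ∃ Q : EAQECC F (q ^ 2 - 1) k c,
        Q.IsConstructedFrom E ∧ Q.MinDistGE (minimalRep (q ^ 2 - 1) q (t + 1) + 1) := by
  have hq1 : 1 < q := hq ▸ Fintype.one_lt_card (α := F)
  have hsq : 1 ≤ q ^ 2 := Nat.one_le_pow _ _ (by omega)
  have hqn := mul_self_modEq_one (show 0 < q by omega)
  have : FiniteDimensional F K := FiniteDimensional.of_finrank_pos (by omega)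
  have : Finite K := Module.finite_of_finite F
  have : Fintype K := Fintype.ofFinite K
  obtain ⟨e, he⟩ := exists_equiv_units (by
    rw [Module.card_eq_pow_finrank (K := F) (V := K), hdeg, hq]) P
  have hE' : E = bchCode F (fun j => (e j : K)) (consecutiveCosets (q ^ 2 - 1) q t) := by
    simp only [hE, he]
  have hmem : ∀ x, x ∈ consecutiveCosets (q ^ 2 - 1) q t ↔
      x < q ^ 2 - 1 ∧ min x (x * q % (q ^ 2 - 1)) ≤ b₀ + b₁ * q := by
    intro x
    rw [mem_consecutiveCosets hqn (by omega), hm, hb]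
  have hclosed : ∀ i ∈ consecutiveCosets (q ^ 2 - 1) q t,
      i * q % (q ^ 2 - 1) ∈ consecutiveCosets (q ^ 2 - 1) q t :=
    fun i hi => mul_mod_mem_consecutiveCosets hqn (by omega) hi
  have hcardΔ := card_consecutiveCosets hqn (t := t) (by omega)
  have hlow : ∀ i < minimalRep (q ^ 2 - 1) q (t + 1), i ∈ consecutiveCosets (q ^ 2 - 1) q t :=
    fun i hi => mem_consecutiveCosets_of_lt hqn ht hi
  set Δ := consecutiveCosets (q ^ 2 - 1) q t
  have hΔ : Δ ⊆ Finset.range (q ^ 2 - 1) := fun x hx => Finset.mem_range.mpr ((hmem x).mp hx).1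
  -- the digits of `m`
  have hrep := (mem_minimalReps hqn).mp (minimalRep_mem (n := q ^ 2 - 1) (q := q) (j := t)
    (by omega))
  rw [hm, hb] at hrep
  have hnot := (digits_lt_iff hb₀ hb₁).mp hrep.1
  have hle : b₁ ≤ b₀ := by
    have h := hrep.2
    rw [swap_digits hb₁ ((digits_lt_iff hb₁ hb₀).mpr (by omega)), digits_le_iff hb₀ hb₁] at h
    omega
  have hb₁' : b₁ + 1 < q := by
    by_contra! h
    have h1 : b₁ = q - 1 := by omega
    exact hnot ⟨by omega, h1⟩
  have hcount := card_filter_min_le hb₀ hb₁' hle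
  have hformula := count_eq_formula hb₀ hb₁' hle hb
  rw [← hcount] at hformula
  have hneg : negExponents (q ^ 2 - 1) Δ ⊆ Finset.range (q ^ 2 - 1) := Finset.filter_subset _ _
  have hcap : Δ ∩ negExponents (q ^ 2 - 1) Δ = (Finset.range (q ^ 2 - 1)).filter fun x =>
      min x (x * q % (q ^ 2 - 1)) ≤ b₀ + b₁ * q ∧
      min ((q ^ 2 - 1 - x) % (q ^ 2 - 1)) ((q ^ 2 - 1 - x) % (q ^ 2 - 1) * q % (q ^ 2 - 1))
        ≤ b₀ + b₁ * q := by
    ext x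
    simp only [negExponents, Finset.mem_inter, Finset.mem_filter, Finset.mem_range, hmem]
    have : x < q ^ 2 - 1 → (q ^ 2 - 1 - x) % (q ^ 2 - 1) < q ^ 2 - 1 :=
      fun h => Nat.mod_lt _ (by omega)
    tauto
  rw [← hcap] at hformula
  have hdimE : Module.finrank F E = Δ.card := by
    rw [hE']
    exact finrank_bchCode e hΔ (by rwa [hq])
  have hdimR : Module.finrank F ↥(E ⊓ euclideanDual E) =
      (Δ \ negExponents (q ^ 2 - 1) Δ).card := by
    rw [hE', bchCode_inf_euclideanDual e hΔ (by rwa [hq])]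
    refine finrank_bchCode e (Finset.sdiff_subset.trans hΔ) fun i hi => ?_
    rw [hq]
    exact mul_mod_mem_sdiff_negExponents hqn hΔ hclosed hi
  have hsplit := Finset.card_inter_add_card_sdiff Δ (negExponents (q ^ 2 - 1) Δ)
  have hunion := Finset.card_union_add_card_inter Δ (negExponents (q ^ 2 - 1) Δ)
  have hunion_le := Finset.card_le_card (Finset.union_subset hΔ hneg)
  rw [card_negExponents hΔ] at hunion
  rw [Finset.card_range] at hunion_le
  set c := (Δ ∩ negExponents (q ^ 2 - 1) Δ).card
  -- The subtraction does not truncate: `2 * Δ.card - c` is the size of `Δ ∪ -Δ`, at most `q ^ 2 -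
  -- 1`.
  refine ⟨q ^ 2 - 1 + c - 2 * Δ.card, c, ?_, hformula, ?_, ?_⟩
  · rw [hdimE, hdimR, ← hsplit]
    push_cast
    ring
  · rw [← Nat.cast_sum, ← hcardΔ]
    have : ((q ^ 2 - 1 : ℕ) : ℤ) = (q : ℤ) ^ 2 - 1 := by
      rw [Nat.cast_sub hsq]
      push_cast
      rfl
    omega
  · refine exists_eaqecc E (by omega) (by omega) fun x hx S hS hxS => ?_
    rw [hE', mem_euclideanDual_bchCode_iff e hΔ (by rwa [hq])] at hx
    have h0 := eq_zero_of_sum_mul_pow_eq_zero (P := fun j => (e j : K))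
      (y := fun j => algebraMap F K (x j)) (Units.val_injective.comp e.injective)
      (fun i hi => hx i (hlow i hi)) (Nat.lt_succ_iff.mp hS) fun j hj => by rw [hxS j hj, map_zero]
    ext j
    exact (map_eq_zero_iff _ (FaithfulSMul.algebraMap_injective F K)).mp (congrFun h0 j)
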